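/- Let $R$ be a principal ideal domain of characteristic zero in which $2$ is invertible (for example, a subring of $\mathbf{Q}$ containing $1/2$). For an $R$-module $M$ let $FM = M/\operatorname{Torsion} M$. A (graded) Lie algebra over $R$ is a non-negatively graded $R$-module $L=\bigoplus_n L_n$ with a bilinear bracket of degree $0$ that satisfies, for homogeneous elements, $[x,y] = -(-1)^{|x||y|}[y,x]$, the graded Jacobi identity $[x,[y,z]]=[[x,y],z]+(-1)^{|x||y|}[y,[x,z]]$, and $[x,[x,x]]=0$ for $|x|$ odd. A differential Lie algebra is a Lie algebra with a differential $\partial$ of degree $-1$, $\partial^2=0$, such that $\partial[x,y]=[\partial x,y]+(-1)^{|x|}[x,\partial y]$. Its universal enveloping algebra $UL$ is the quotient of the tensor algebra of $L$ by the relations $xy-(-1)^{|x||y|}yx=[x,y]$ ($x,y\in L$ homogeneous), with the derivation that extends $\partial$ as differential and with the diagonal $\Delta:UL\to UL\otimes UL$, the morphism of graded algebras that extends $x\mapsto x\otimes 1+1\otimes x$. Let $\iota:L\to UL$ be the canonical map, and let $\kappa:H(UL)\otimes H(UL)\to H(UL\otimes UL)$, $[u]\otimes[v]\mapsto[u\otimes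 v]$, be the Künneth map. Let $P\subset FH(UL)$ be the submodule of primitive elements of the Hopf algebra $FH(UL)$, whose diagonal is $(F\kappa)^{-1}\circ FH(\Delta)$; that is, $P$ consists of the $x$ with $FH(\Delta)(x)=F\kappa(x\otimes 1+1\otimes x)$. Let $(L,\partial)$ be a differential Lie algebra over $R$ that is connected ($L_n=0$ for $n\le 0$), and such that each $L_n$ is a free $R$-module of finite rank. Then $P$ is closed under the graded commutator bracket $[x,y]=xy-(-1)^{|x||y|}yx$ of $FH(UL)$ (so that it is a sub-Lie algebra), the map induced by $\iota$ takes values in $P$, and $$F\iota_*: FH(L)\longrightarrow P$$ is an injective morphism of graded Lie algebras. Moreover the cokernel $P/\operatorname{im}F\iota_*$ is a torsion $R$-module. -/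

import Mathlib

noncomputable section

open scoped TensorProduct DirectSum

/-! ### Graded Lie algebras and differential Lie algebras -/

/-- The sign `(-1)^n`, as an element of `R`. -/
def ksign (R : Type*) [CommRing R] (n : ℤ) : R := ((n.negOnePow : ℤ) : R)

theorem ksign_add (R : Type*) [CommRing R] (m n : ℤ) :
    ksign R (m + n) = ksign R m * ksign R n := by
  simp [ksign, Int.negOnePow_add]

theorem ksign_sub (R : Type*) [CommRing R] (m n : ℤ) :
    ksign R (m - n) = ksign R m * ksign R n := by
  simp [ksign, Int.negOnePow_sub]

theorem ksign_mul_self (R : Type*) [CommRing R] (n : ℤ) :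
    ksign R n * ksign R n = 1 := by
  rw [← ksign_add]
  simp [ksign, ← two_mul]

theorem ksign_one (R : Type*) [CommRing R] : ksign R 1 = -1 := by
  simp [ksign]

theorem ksign_zero (R : Type*) [CommRing R] : ksign R 0 = 1 := by
  simp [ksign]

/-- A graded Lie algebra structure on the `R`-module `L = ⨁ₙ Lₙ`, concentrated in non-negative
degrees: the bracket is graded anti-symmetric, satisfies the graded Jacobi identity, and
`[x, [x, x]] = 0` for `x` of odd degree. -/
structure GrLieAlgebra (R : Type*) (L : Type*) [CommRing R] [AddCommGroup L] [Module R L] where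
  /-- the submodule of elements of degree `n` -/
  gr : ℤ → Submodule R L
  isInternal : DirectSum.IsInternal gr
  gr_neg : ∀ n < 0, gr n = ⊥
  bracket : L →ₗ[R] L →ₗ[R] L
  bracket_mem : ∀ {m n : ℤ} {x y : L}, x ∈ gr m → y ∈ gr n → bracket x y ∈ gr (m + n)
  antisymm : ∀ {m n : ℤ} {x y : L}, x ∈ gr m → y ∈ gr n →
    bracket x y = -(ksign R (m * n) • bracket y x)
  jacobi : ∀ {m n k : ℤ} {x y z : L}, x ∈ gr m → y ∈ gr n → z ∈ gr k →
    bracket x (bracket y z) =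
      bracket (bracket x y) z + ksign R (m * n) • bracket y (bracket x z)
  odd_cube : ∀ {n : ℤ} {x : L}, Odd n → x ∈ gr n → bracket x (bracket x x) = 0

/-- A differential Lie algebra: a graded Lie algebra with a differential of degree `-1` that
satisfies the Leibniz rule `d[x, y] = [dx, y] + (-1)^{|x|} [x, dy]`. -/
structure DGLieAlgebra (R : Type*) (L : Type*) [CommRing R] [AddCommGroup L] [Module R L]
    extends GrLieAlgebra R L where
  d : L →ₗ[R] L
  d_mem : ∀ {n : ℤ} {x : L}, x ∈ gr n → d x ∈ gr (n - 1)
  d_d : ∀ x : L, d (d x) = 0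
  leibniz : ∀ {m n : ℤ} {x y : L}, x ∈ gr m → y ∈ gr n →
    d (bracket x y) = bracket (d x) y + ksign R m • bracket x (d y)

/-- Concentrated in strictly positive degrees. -/
def GrLieAlgebra.Connected {R L : Type*} [CommRing R] [AddCommGroup L] [Module R L]
    (𝔤 : GrLieAlgebra R L) : Prop :=
  ∀ n ≤ 0, 𝔤.gr n = ⊥

/-! ### Homology modulo torsion -/

section Homology

variable {R : Type*} [CommRing R]
variable {C C₁ C₂ C₃ : Type*} [AddCommGroup C] [Module R C] [AddCommGroup C₁] [Module R C₁]
  [AddCommGroup C₂] [Module R C₂] [AddCommGroup C₃] [Module R C₃]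

/-- The (total) homology `ker d / im d` of a module `C` with differential `d`. -/
abbrev Homology (d : C →ₗ[R] C) : Type _ :=
  LinearMap.ker d ⧸ (LinearMap.range d).comap (LinearMap.ker d).subtype

/-- The free part `F H(C) = H(C) / Torsion H(C)` of the homology. -/
abbrev FreeHomology (d : C →ₗ[R] C) : Type _ :=
  Homology d ⧸ Submodule.torsion R (Homology d)

namespace FreeHomology

/-- The class in `F H(C)` of a cycle. -/
def mk (d : C →ₗ[R] C) : LinearMap.ker d →ₗ[R] FreeHomology d :=
  (Submodule.torsion R (Homology d)).mkQ ∘ₗ Submodule.mkQ _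

theorem mk_surjective (d : C →ₗ[R] C) : Function.Surjective (mk d) :=
  (Submodule.mkQ_surjective _).comp (Submodule.mkQ_surjective _)

theorem mk_eq_zero_of_boundary {d : C →ₗ[R] C} (z : LinearMap.ker d) {w : C}
    (h : (z : C) = d w) : mk d z = 0 := by
  have : (Submodule.mkQ ((LinearMap.range d).comap (LinearMap.ker d).subtype)) z = 0 := by
    rw [Submodule.mkQ_apply, Submodule.Quotient.mk_eq_zero]
    exact ⟨w, h.symm⟩
  simp [mk, this]

theorem eq_zero_of_smul {d : C →ₗ[R] C} {a : R} (ha : a ∈ nonZeroDivisors R)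
    {x : FreeHomology d} (h : a • x = 0) : x = 0 := by
  have h1 : x ∈ Submodule.torsion R (FreeHomology d) := ⟨⟨a, ha⟩, h⟩
  rwa [Submodule.QuotientTorsion.torsion_eq_bot, Submodule.mem_bot] at h1

theorem mk_eq_zero_iff {d : C →ₗ[R] C} (z : LinearMap.ker d) :
    mk d z = 0 ↔ ∃ a ∈ nonZeroDivisors R, ∃ w, a • (z : C) = d w := by
  constructor
  · intro h
    simp only [mk, LinearMap.comp_apply, Submodule.mkQ_apply, Submodule.Quotient.mk_eq_zero] at h
    obtain ⟨a, ha⟩ := h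
    have ha' : (Submodule.Quotient.mk ((a : R) • z) : Homology d) = 0 := ha
    rw [Submodule.Quotient.mk_eq_zero] at ha'
    obtain ⟨w, hw⟩ := ha'
    exact ⟨a, a.2, w, hw.symm⟩
  · rintro ⟨a, ha, w, hw⟩
    apply eq_zero_of_smul ha
    rw [← map_smul]
    exact mk_eq_zero_of_boundary _ hw

/-- The universal property of `F H(C)`: a linear map on cycles that kills the boundaries, with
values in a torsion-free module, factors through `F H(C)`. -/
def lift {d : C →ₗ[R] C} {M : Type*} [AddCommGroup M] [Module R M]
    (f : LinearMap.ker d →ₗ[R] M) (hM : ∀ a ∈ nonZeroDivisors R, ∀ x : M, a • x = 0 → x = 0)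
    (hf : ∀ z : LinearMap.ker d, ∀ w, (z : C) = d w → f z = 0) : FreeHomology d →ₗ[R] M :=
  Submodule.liftQ _
    (Submodule.liftQ _ f (by rintro z ⟨w, hw⟩; exact hf z w hw.symm))
    (by
      rintro x ⟨a, ha⟩
      refine hM a a.2 _ ?_
      rw [← map_smul]
      have : (a : R) • x = 0 := ha
      rw [this, map_zero])

@[simp]
theorem lift_mk {d : C →ₗ[R] C} {M : Type*} [AddCommGroup M] [Module R M]
    (f : LinearMap.ker d →ₗ[R] M) (hM) (hf) (z : LinearMap.ker d) :
    lift f hM hf (mk d z) = f z := rfl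

/-- The map `F H(C₁) → F H(C₂)` induced by a chain map. -/
def map {d₁ : C₁ →ₗ[R] C₁} {d₂ : C₂ →ₗ[R] C₂} (f : C₁ →ₗ[R] C₂)
    (hf : ∀ x, d₂ (f x) = f (d₁ x)) : FreeHomology d₁ →ₗ[R] FreeHomology d₂ :=
  lift (mk d₂ ∘ₗ f.restrict (p := LinearMap.ker d₁) (q := LinearMap.ker d₂)
      (fun x hx => by
        rw [LinearMap.mem_ker] at hx ⊢
        rw [hf, hx, map_zero]))
    (fun _ ha _ hx => eq_zero_of_smul ha hx)
    (fun z w h => mk_eq_zero_of_boundary (w := f w) _ (by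
      simp [h, hf]))

/-- `b : C₁ × C₂ → C₃` is a bilinear map of complexes:
`d(b(x, y)) = b(dx, y) + b(s x, dy)`, where `s` is the sign involution `x ↦ (-1)^{|x|} x`
of `C₁`. -/
structure IsPairing (d₁ : C₁ →ₗ[R] C₁) (d₂ : C₂ →ₗ[R] C₂) (d₃ : C₃ →ₗ[R] C₃)
    (s : C₁ →ₗ[R] C₁) (b : C₁ →ₗ[R] C₂ →ₗ[R] C₃) : Prop where
  leibniz : ∀ x y, d₃ (b x y) = b (d₁ x) y + b (s x) (d₂ y)
  s_s : ∀ x, s (s x) = x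
  d_s : ∀ x, d₁ (s x) = - s (d₁ x)

variable {d₁ : C₁ →ₗ[R] C₁} {d₂ : C₂ →ₗ[R] C₂} {d₃ : C₃ →ₗ[R] C₃}
  {s : C₁ →ₗ[R] C₁} {b : C₁ →ₗ[R] C₂ →ₗ[R] C₃}

theorem IsPairing.mem_ker (h : IsPairing d₁ d₂ d₃ s b) (x : LinearMap.ker d₁)
    (y : LinearMap.ker d₂) : b x y ∈ LinearMap.ker d₃ := by
  have hx := x.2
  have hy := y.2
  rw [LinearMap.mem_ker] at hx hy ⊢
  rw [h.leibniz, hx, hy]; simp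

/-- The pairing on cycles, with values in `F H(C₃)`. -/
def cyclePairing (h : IsPairing d₁ d₂ d₃ s b) :
    LinearMap.ker d₁ →ₗ[R] LinearMap.ker d₂ →ₗ[R] FreeHomology d₃ :=
  LinearMap.mk₂ R (fun x y => mk d₃ ⟨b x y, h.mem_ker x y⟩)
    (fun x x' y => by rw [← map_add]; congr 1; ext; simp)
    (fun c x y => by rw [← map_smul]; congr 1; ext; simp)
    (fun x y y' => by rw [← map_add]; congr 1; ext; simp)
    (fun c x y => by rw [← map_smul]; congr 1; ext; simp)

/-- The bilinear map `F H(C₁) × F H(C₂) → F H(C₃)`, `([x], [y]) ↦ [b(x, y)]`, induced by a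
bilinear map of complexes. -/
def map₂ (h : IsPairing d₁ d₂ d₃ s b) :
    FreeHomology d₁ →ₗ[R] FreeHomology d₂ →ₗ[R] FreeHomology d₃ :=
  lift
    (LinearMap.flip
      (lift (LinearMap.flip (cyclePairing h))
        (fun a ha f hf => LinearMap.ext fun x => eq_zero_of_smul ha (LinearMap.congr_fun hf x))
        (fun z w hz => LinearMap.ext fun x =>
          mk_eq_zero_of_boundary (w := b (s x) w) _ (by
            have hx := x.2
            rw [LinearMap.mem_ker] at hx
            simp [h.leibniz, h.s_s, h.d_s, hx, hz]))))
    (fun a ha f hf => LinearMap.ext fun x => eq_zero_of_smul ha (LinearMap.congr_fun hf x))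
    (fun z w hz => LinearMap.ext fun y => by
      obtain ⟨y, rfl⟩ := mk_surjective _ y
      refine mk_eq_zero_of_boundary (w := b w y) _ ?_
      have hy := y.2
      rw [LinearMap.mem_ker] at hy
      simp [h.leibniz, hy, hz])

theorem map₂_mk (h : IsPairing d₁ d₂ d₃ s b) (x : LinearMap.ker d₁) (y : LinearMap.ker d₂) :
    map₂ h (mk d₁ x) (mk d₂ y) = mk d₃ ⟨b x y, h.mem_ker x y⟩ := rfl

/-- The submodule of `F H(C)` of classes of cycles that lie in the submodule `p` of `C`. Applied
to the submodule of elements of degree `n` this is the degree `n` part of `F H(C)`. -/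
def part (d : C →ₗ[R] C) (p : Submodule R C) : Submodule R (FreeHomology d) :=
  (p.comap (LinearMap.ker d).subtype).map (mk d)

end FreeHomology

end Homology

/-! ### The universal enveloping algebra -/

namespace GrLieAlgebra

variable {R L : Type*} [CommRing R] [AddCommGroup L] [Module R L] (𝔤 : GrLieAlgebra R L)

/-- The decomposition of `L` into its homogeneous parts. -/
instance decomposition : DirectSum.Decomposition 𝔤.gr := 𝔤.isInternal.chooseDecomposition

theorem hom_induction {p : L → Prop} (x : L) (h0 : p 0)
    (hh : ∀ n, ∀ y ∈ 𝔤.gr n, p y) (ha : ∀ y z, p y → p z → p (y + z)) : p x :=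
  DirectSum.Decomposition.inductionOn 𝔤.gr h0 (fun {i} m => hh i m m.2) ha x

/-- The linear map that is `f n` on the part of degree `n`. -/
def ofParts {M : Type*} [AddCommMonoid M] [Module R M] (f : ∀ n, 𝔤.gr n →ₗ[R] M) : L →ₗ[R] M :=
  DirectSum.toModule R ℤ M f ∘ₗ (DirectSum.decomposeLinearEquiv 𝔤.gr).toLinearMap

theorem ofParts_apply {M : Type*} [AddCommMonoid M] [Module R M] (f : ∀ n, 𝔤.gr n →ₗ[R] M)
    {n : ℤ} {x : L} (hx : x ∈ 𝔤.gr n) : 𝔤.ofParts f x = f n ⟨x, hx⟩ := by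
  simp only [ofParts, LinearMap.comp_apply, LinearEquiv.coe_coe,
    DirectSum.decomposeLinearEquiv_apply]
  rw [DirectSum.decompose_of_mem 𝔤.gr hx, ← DirectSum.lof_eq_of R, DirectSum.toModule_lof]

/-- The sign involution `x ↦ (-1)^{|x|} x` of `L`. -/
def sign : L →ₗ[R] L := 𝔤.ofParts fun n => ksign R n • (𝔤.gr n).subtype

theorem sign_apply {n : ℤ} {x : L} (hx : x ∈ 𝔤.gr n) : 𝔤.sign x = ksign R n • x := by
  rw [sign, ofParts_apply 𝔤 _ hx]; rfl

theorem sign_sign (x : L) : 𝔤.sign (𝔤.sign x) = x := by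
  induction x using 𝔤.hom_induction with
  | h0 => simp
  | hh n y hy => rw [sign_apply 𝔤 hy, map_smul, sign_apply 𝔤 hy, smul_smul, ksign_mul_self, one_smul]
  | ha y z hy hz => simp [hy, hz]

/-- The relations `x y - (-1)^{|x||y|} y x = [x, y]`, for homogeneous `x` and `y` in `L`, on the
tensor algebra of `L`. -/
inductive Rel : TensorAlgebra R L → TensorAlgebra R L → Prop
  | bracket (m n : ℤ) (x y : L) (hx : x ∈ 𝔤.gr m) (hy : y ∈ 𝔤.gr n) :
      Rel (TensorAlgebra.ι R x * TensorAlgebra.ι R y -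
          ksign R (m * n) • (TensorAlgebra.ι R y * TensorAlgebra.ι R x))
        (TensorAlgebra.ι R (𝔤.bracket x y))

/-- The universal enveloping algebra `UL` of the graded Lie algebra `L`. -/
def U : Type _ := RingQuot 𝔤.Rel

instance : Ring 𝔤.U := inferInstanceAs (Ring (RingQuot 𝔤.Rel))

instance : Algebra R 𝔤.U := inferInstanceAs (Algebra R (RingQuot 𝔤.Rel))

/-- The canonical map `L → UL`. -/
def ι : L →ₗ[R] 𝔤.U := (RingQuot.mkAlgHom R 𝔤.Rel).toLinearMap ∘ₗ TensorAlgebra.ι R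

theorem ι_bracket {m n : ℤ} {x y : L} (hx : x ∈ 𝔤.gr m) (hy : y ∈ 𝔤.gr n) :
    𝔤.ι (𝔤.bracket x y) = 𝔤.ι x * 𝔤.ι y - ksign R (m * n) • (𝔤.ι y * 𝔤.ι x) := by
  have h := RingQuot.mkAlgHom_rel R (Rel.bracket (𝔤 := 𝔤) m n x y hx hy)
  rw [map_sub, map_smul, map_mul, map_mul] at h
  exact h.symm

/-- `f : L → A` sends the bracket to graded commutators. -/
def IsLieMap {A : Type*} [Ring A] [Algebra R A] (f : L →ₗ[R] A) : Prop :=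
  ∀ (m n : ℤ) (x y : L), x ∈ 𝔤.gr m → y ∈ 𝔤.gr n →
    f x * f y - ksign R (m * n) • (f y * f x) = f (𝔤.bracket x y)

variable {𝔤}

/-- The universal property of `UL`. -/
def lift {A : Type*} [Ring A] [Algebra R A] (f : L →ₗ[R] A) (hf : 𝔤.IsLieMap f) :
    𝔤.U →ₐ[R] A :=
  RingQuot.liftAlgHom R ⟨TensorAlgebra.lift R f, by
    rintro _ _ ⟨m, n, x, y, hx, hy⟩
    simpa using hf m n x y hx hy⟩

@[simp]
theorem lift_ι {A : Type*} [Ring A] [Algebra R A] (f : L →ₗ[R] A) (hf : 𝔤.IsLieMap f) (x : L) :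
    lift f hf (𝔤.ι x) = f x := by
  have h := RingQuot.liftAlgHom_mkAlgHom_apply R (TensorAlgebra.lift R f)
    (s := 𝔤.Rel) (by
      rintro _ _ ⟨m, n, x, y, hx, hy⟩
      simpa using hf m n x y hx hy) (TensorAlgebra.ι R x)
  rw [TensorAlgebra.lift_ι_apply] at h
  exact h

theorem algHom_ext {A : Type*} [Ring A] [Algebra R A] {f g : 𝔤.U →ₐ[R] A}
    (h : ∀ x, f (𝔤.ι x) = g (𝔤.ι x)) : f = g := by
  apply RingQuot.ringQuot_ext'
  apply TensorAlgebra.hom_ext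
  ext x
  exact h x

variable (𝔤)

/-- `Mon n u`: the element `u` of `UL` is a product `x₁ ⋯ x_k` of homogeneous elements of `L` with
`|x₁| + ⋯ + |x_k| = n`. -/
inductive Mon : ℤ → 𝔤.U → Prop
  | one : Mon 0 1
  | mul {m n : ℤ} {x : L} {u : 𝔤.U} : x ∈ 𝔤.gr m → Mon n u → Mon (m + n) (𝔤.ι x * u)

/-- The elements of degree `n` of `UL`. -/
def grU (n : ℤ) : Submodule R 𝔤.U := Submodule.span R {u | 𝔤.Mon n u}

variable {𝔤}

theorem Mon.mul' {m n : ℤ} {u v : 𝔤.U} (hu : 𝔤.Mon m u) (hv : 𝔤.Mon n v) :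
    𝔤.Mon (m + n) (u * v) := by
  induction hu with
  | one => simpa using hv
  | mul hx _ ih => rw [mul_assoc, add_assoc]; exact Mon.mul hx ih

theorem ι_mem {n : ℤ} {x : L} (hx : x ∈ 𝔤.gr n) : 𝔤.ι x ∈ 𝔤.grU n := by
  have := Mon.mul hx (Mon.one (𝔤 := 𝔤))
  rw [add_zero, mul_one] at this
  exact Submodule.subset_span this

instance gradedMonoid : SetLike.GradedMonoid 𝔤.grU where
  one_mem := Submodule.subset_span Mon.one
  mul_mem i j u v hu hv := by
    induction hu using Submodule.span_induction with
    | mem u hu =>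
      induction hv using Submodule.span_induction with
      | mem v hv => exact Submodule.subset_span (hu.mul' hv)
      | zero => simp
      | add v w _ _ hv hw => rw [mul_add]; exact add_mem hv hw
      | smul a v _ hv => rw [mul_smul_comm]; exact Submodule.smul_mem _ _ hv
    | zero => simp
    | add u w _ _ hu hw => rw [add_mul]; exact add_mem hu hw
    | smul a u _ hu => rw [smul_mul_assoc]; exact Submodule.smul_mem _ _ hu

variable (𝔤)

/-- The canonical map `L → UL`, with values in `⨁ₙ (UL)ₙ`. -/
def gradedι : L →ₗ[R] ⨁ n, 𝔤.grU n :=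
  𝔤.ofParts fun n => DirectSum.lof R ℤ (fun n => 𝔤.grU n) n ∘ₗ
    (𝔤.ι ∘ₗ (𝔤.gr n).subtype).codRestrict (𝔤.grU n) fun x => ι_mem x.2

variable {𝔤}

theorem gradedι_apply {n : ℤ} {x : L} (hx : x ∈ 𝔤.gr n) :
    𝔤.gradedι x = DirectSum.of (fun n => 𝔤.grU n) n ⟨𝔤.ι x, ι_mem hx⟩ := by
  rw [gradedι, ofParts_apply 𝔤 _ hx]; rfl

theorem gradedι_isLieMap : 𝔤.IsLieMap (A := ⨁ n, 𝔤.grU n) 𝔤.gradedι := by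
  intro m n x y hx hy
  rw [gradedι_apply hx, gradedι_apply hy, gradedι_apply (𝔤.bracket_mem hx hy),
    DirectSum.of_mul_of, DirectSum.of_mul_of]
  have : DirectSum.of (fun n => 𝔤.grU n) (n + m)
      (GradedMonoid.GMul.mul (A := fun n => 𝔤.grU n) (⟨𝔤.ι y, ι_mem hy⟩ : 𝔤.grU n) (⟨𝔤.ι x, ι_mem hx⟩ : 𝔤.grU m)) =
      DirectSum.of (fun n => 𝔤.grU n) (m + n) ⟨𝔤.ι y * 𝔤.ι x, by
        rw [add_comm]; exact SetLike.mul_mem_graded (ι_mem hy) (ι_mem hx)⟩ := by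
    refine DirectSum.of_eq_of_gradedMonoid_eq (Sigma.subtype_ext (add_comm _ _) ?_)
    rfl
  have hs : ∀ (r : R) (v : 𝔤.grU (m + n)), r • DirectSum.of (fun n => 𝔤.grU n) (m + n) v =
      DirectSum.of (fun n => 𝔤.grU n) (m + n) (r • v) := fun r v =>
    ((DirectSum.lof R ℤ (fun n => 𝔤.grU n) (m + n)).map_smul r v).symm
  rw [this, hs, sub_eq_iff_eq_add, ← map_add]
  congr 1
  ext
  exact eq_add_of_sub_eq (𝔤.ι_bracket hx hy).symm

variable (𝔤) in
/-- The algebra morphism `UL → ⨁ₙ (UL)ₙ` that decomposes an element into its homogeneous parts. -/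
def decomposeU : 𝔤.U →ₐ[R] ⨁ n, 𝔤.grU n :=
  lift (A := ⨁ n, 𝔤.grU n) 𝔤.gradedι gradedι_isLieMap

theorem decomposeU_ι (x : L) : 𝔤.decomposeU (𝔤.ι x) = 𝔤.gradedι x :=
  lift_ι (A := ⨁ n, 𝔤.grU n) _ gradedι_isLieMap x

theorem decomposeU_of_mem {n : ℤ} (u : 𝔤.grU n) :
    𝔤.decomposeU u = DirectSum.of (fun n => 𝔤.grU n) n u := by
  obtain ⟨u, hu⟩ := u
  simp only
  induction hu using Submodule.span_induction with
  | mem u hu =>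
    induction hu with
    | one => rw [map_one]; rfl
    | mul hx hu ih =>
      rw [map_mul, decomposeU_ι, gradedι_apply hx, ih, DirectSum.of_mul_of]
      rfl
  | zero => rw [map_zero]; exact (map_zero _).symm
  | add u v hu hv h1 h2 => rw [map_add, h1, h2, ← map_add]; rfl
  | smul a u hu h =>
    rw [map_smul, h, ← DirectSum.lof_eq_of R, ← map_smul]; rfl

/-- `UL` is a graded algebra. -/
instance gradedAlgebra : GradedAlgebra 𝔤.grU :=
  GradedAlgebra.ofAlgHom 𝔤.grU 𝔤.decomposeU
    (by
      apply algHom_ext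
      intro x
      induction x using 𝔤.hom_induction with
      | h0 => simp
      | hh n y hy =>
        rw [AlgHom.comp_apply, decomposeU_ι, gradedι_apply hy]
        simp
      | ha y z hy hz => simpa using congrArg₂ (· + ·) hy hz)
    (fun _ => decomposeU_of_mem)

theorem Mon.mem {n : ℤ} {u : 𝔤.U} (hu : 𝔤.Mon n u) : u ∈ 𝔤.grU n := Submodule.subset_span hu

/-- A linear statement about `UL` may be checked on monomials. -/
theorem mon_induction {p : 𝔤.U → Prop} (u : 𝔤.U) (h0 : p 0) (hm : ∀ n, ∀ v, 𝔤.Mon n v → p v)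
    (ha : ∀ v w, p v → p w → p (v + w)) (hs : ∀ (a : R) v, p v → p (a • v)) : p u := by
  refine DirectSum.Decomposition.inductionOn 𝔤.grU h0 (fun {i} m => ?_) ha u
  obtain ⟨m, hm'⟩ := m
  simp only
  induction hm' using Submodule.span_induction with
  | mem v hv => exact hm i v hv
  | zero => exact h0
  | add v w _ _ hv hw => exact ha v w hv hw
  | smul a v _ hv => exact hs a v hv

theorem mon_linearMap_ext {M : Type*} [AddCommGroup M] [Module R M] {f g : 𝔤.U →ₗ[R] M}
    (h : ∀ n, ∀ u, 𝔤.Mon n u → f u = g u) : f = g := by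
  ext u
  induction u using mon_induction with
  | h0 => simp
  | hm n v hv => exact h n v hv
  | ha v w hv hw => simp [hv, hw]
  | hs a v hv => simp [hv]

variable (𝔤)

theorem ι_sign_isLieMap : 𝔤.IsLieMap (𝔤.ι ∘ₗ 𝔤.sign) := by
  intro m n x y hx hy
  simp only [LinearMap.comp_apply, sign_apply 𝔤 hx, sign_apply 𝔤 hy,
    sign_apply 𝔤 (𝔤.bracket_mem hx hy), map_smul, ι_bracket 𝔤 hx hy, ksign_add, smul_mul_assoc,
    mul_smul_comm, smul_sub, smul_smul]
  congr 2 <;> ring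

/-- The sign involution `u ↦ (-1)^{|u|} u` of `UL`. -/
def signU : 𝔤.U →ₐ[R] 𝔤.U := lift (𝔤.ι ∘ₗ 𝔤.sign) 𝔤.ι_sign_isLieMap

variable {𝔤}

theorem signU_ι {n : ℤ} {x : L} (hx : x ∈ 𝔤.gr n) : 𝔤.signU (𝔤.ι x) = ksign R n • 𝔤.ι x := by
  rw [signU, lift_ι, LinearMap.comp_apply, sign_apply 𝔤 hx, map_smul]

theorem signU_apply {n : ℤ} {u : 𝔤.U} (hu : u ∈ 𝔤.grU n) : 𝔤.signU u = ksign R n • u := by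
  induction hu using Submodule.span_induction with
  | mem u hu =>
    induction hu with
    | one => simp [ksign_zero]
    | mul hx hu ih =>
      rw [map_mul, signU_ι hx, ih, ksign_add, smul_mul_assoc, mul_smul_comm, smul_smul]
  | zero => simp
  | add u v hu hv h1 h2 => rw [map_add, h1, h2, smul_add]
  | smul a u hu h => rw [map_smul, h, smul_comm]

theorem signU_signU (u : 𝔤.U) : 𝔤.signU (𝔤.signU u) = u := by
  have : 𝔤.signU.comp 𝔤.signU = AlgHom.id R _ := by
    apply algHom_ext
    intro x
    simp [signU, sign_sign]
  exact DFunLike.congr_fun this u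

/-! ### The diagonal of the universal enveloping algebra -/

variable (𝔤)

/-- `UL ⊗ UL`, with the multiplication `(a ⊗ b)(a' ⊗ b') = (-1)^{|b||a'|} aa' ⊗ bb'`. -/
abbrev UU : Type _ := 𝔤.grU ᵍ⊗[R] 𝔤.grU

instance : SMulCommClass R 𝔤.UU 𝔤.UU := Algebra.to_smulCommClass

instance : IsScalarTower R 𝔤.UU 𝔤.UU := IsScalarTower.right

open GradedTensorProduct in
theorem tmul_mul_tmul {m n : ℤ} (a : 𝔤.U) {b a' : 𝔤.U} (b' : 𝔤.U) (hb : b ∈ 𝔤.grU m)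
    (ha' : a' ∈ 𝔤.grU n) :
    (tmul R a b * tmul R a' b' : 𝔤.UU) = ksign R (m * n) • tmul R (a * a') (b * b') := by
  have h := tmul_coe_mul_coe_tmul (R := R) 𝔤.grU 𝔤.grU a ⟨b, hb⟩ ⟨a', ha'⟩ b'
  refine h.trans ?_
  rw [ksign, Int.cast_smul_eq_zsmul]
  rfl

/-- The linear map `x ↦ x ⊗ 1 + 1 ⊗ x`. -/
def primitiveι : L →ₗ[R] 𝔤.UU :=
  ((GradedTensorProduct.includeLeft 𝔤.grU 𝔤.grU).toLinearMap +
    (GradedTensorProduct.includeRight 𝔤.grU 𝔤.grU).toLinearMap) ∘ₗ 𝔤.ι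

theorem primitiveι_apply (x : L) : 𝔤.primitiveι x =
    GradedTensorProduct.tmul R (𝔤.ι x) 1 + GradedTensorProduct.tmul R 1 (𝔤.ι x) := rfl

theorem one_mem_grU : (1 : 𝔤.U) ∈ 𝔤.grU 0 := SetLike.one_mem_graded _

theorem primitiveι_isLieMap : 𝔤.IsLieMap 𝔤.primitiveι := by
  intro m n x y hx hy
  have h1 := 𝔤.one_mem_grU
  have hx' := ι_mem hx
  have hy' := ι_mem hy
  simp only [primitiveι_apply, ι_bracket 𝔤 hx hy, mul_add, add_mul]
  rw [tmul_mul_tmul 𝔤 _ _ h1 hy', tmul_mul_tmul 𝔤 _ _ h1 h1, tmul_mul_tmul 𝔤 _ _ hx' hy',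
    tmul_mul_tmul 𝔤 _ _ hx' h1, tmul_mul_tmul 𝔤 _ _ h1 hx', tmul_mul_tmul 𝔤 _ _ h1 h1,
    tmul_mul_tmul 𝔤 _ _ hy' hx', tmul_mul_tmul 𝔤 _ _ hy' h1]
  have hc : ksign R (m * n) * ksign R (n * m) = 1 := by rw [mul_comm n m, ksign_mul_self]
  simp only [mul_one, one_mul, zero_mul, mul_zero, ksign_zero, one_smul, smul_add, smul_smul, hc,
    GradedTensorProduct.tmul, TensorProduct.sub_tmul, TensorProduct.tmul_sub, map_sub,
    TensorProduct.smul_tmul', TensorProduct.tmul_smul]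
  abel

/-- The diagonal `UL → UL ⊗ UL`: the algebra morphism that extends `x ↦ x ⊗ 1 + 1 ⊗ x`. -/
def diag : 𝔤.U →ₐ[R] 𝔤.UU := lift 𝔤.primitiveι 𝔤.primitiveι_isLieMap

end GrLieAlgebra

/-! ### Injectivity of the Künneth map -/

section Kunneth

theorem baer_fractionRing (R : Type*) [CommRing R] [IsDomain R] [IsPrincipalIdealRing R] :
    Module.Baer R (FractionRing R) := by
  intro I g
  obtain ⟨a, rfl⟩ := (IsPrincipalIdealRing.principal I).principal
  have ha : a ∈ Submodule.span R {a} := Submodule.mem_span_singleton_self a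
  by_cases h0 : a = 0
  · refine ⟨0, fun x hx => ?_⟩
    have : (⟨x, hx⟩ : Submodule.span R {a}) = 0 := by
      ext; subst h0; simpa using hx
    rw [this]; simp
  · have h0' : algebraMap R (FractionRing R) a ≠ 0 := by
      simpa using h0
    refine ⟨LinearMap.toSpanSingleton R _ (g ⟨a, ha⟩ / algebraMap R _ a), fun x hx => ?_⟩
    obtain ⟨r, rfl⟩ := Submodule.mem_span_singleton.1 hx
    have : (⟨r • a, hx⟩ : Submodule.span R {a}) = r • ⟨a, ha⟩ := rfl
    rw [this, map_smul, map_smul, LinearMap.toSpanSingleton_apply, Algebra.smul_def a,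
      mul_div_cancel₀ _ h0']

theorem tensor_eq_zero {R M N : Type*} [CommRing R] [IsDomain R] [IsPrincipalIdealRing R]
    [AddCommGroup M] [Module R M] [AddCommGroup N] [Module R N]
    [Module.IsTorsionFree R M] [Module.IsTorsionFree R N] (t : M ⊗[R] N)
    (h : ∀ (f : M →ₗ[R] FractionRing R) (g : N →ₗ[R] FractionRing R),
      LinearMap.mul' R _ (TensorProduct.map f g t) = 0) : t = 0 := by
  obtain ⟨M', _, hM'⟩ := TensorProduct.exists_finite_submodule_left_of_setFinite {t}
    (Set.finite_singleton t)
  obtain ⟨t, rfl⟩ := hM' (Set.mem_singleton t)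
  obtain ⟨c, rfl⟩ := TensorProduct.eq_repr_basis_left (Module.Free.chooseBasis R M') t
  set e := Module.Free.chooseBasis R M'
  suffices c = 0 by simp [this]
  ext i
  by_contra hi
  obtain ⟨g, hg⟩ := (baer_fractionRing R).extension_property
    (LinearMap.toSpanSingleton R N (c i)) (by
      intro r r' hr
      have : (r - r') • c i = 0 := by
        simpa [sub_smul, sub_eq_zero] using hr
      rcases smul_eq_zero.1 this with h | h
      · exact sub_eq_zero.1 h
      · exact absurd h hi)
    (Algebra.linearMap R (FractionRing R))
  obtain ⟨f, hf⟩ := (baer_fractionRing R).extension_property M'.subtype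
    M'.injective_subtype (Algebra.linearMap R (FractionRing R) ∘ₗ e.coord i)
  have hf' : ∀ j, f (e j) = if j = i then 1 else 0 := by
    intro j
    have := LinearMap.congr_fun hf (e j)
    simp only [LinearMap.comp_apply, Submodule.subtype_apply] at this
    rw [this]
    classical
    simp [Finsupp.single_apply]
  have hg' : g (c i) = 1 := by
    have := LinearMap.congr_fun hg 1
    simpa using this
  have := h f g
  simp [Finsupp.sum, hf', hg'] at this
  exact hi this

end Kunneth

/-! ### The differentials of `UL` and `UL ⊗ UL` -/

namespace DGLieAlgebra

variable {R L : Type*} [CommRing R] [AddCommGroup L] [Module R L] (𝔏 : DGLieAlgebra R L)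

open GrLieAlgebra FreeHomology

theorem d_sign (x : L) : 𝔏.d (𝔏.sign x) = -𝔏.sign (𝔏.d x) := by
  induction x using 𝔏.hom_induction with
  | h0 => simp
  | hh n y hy =>
    rw [sign_apply _ hy, map_smul, sign_apply _ (𝔏.d_mem hy), ksign_sub, ksign_one]
    simp
  | ha y z hy hz => simp only [map_add, hy, hz]; abel

theorem d_bracket (x y : L) :
    𝔏.d (𝔏.bracket x y) = 𝔏.bracket (𝔏.d x) y + 𝔏.bracket (𝔏.sign x) (𝔏.d y) := by
  induction x using 𝔏.hom_induction with
  | h0 => simp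
  | hh m x hx =>
    induction y using 𝔏.hom_induction with
    | h0 => simp
    | hh n y hy => rw [𝔏.leibniz hx hy, sign_apply _ hx]; simp
    | ha y z hy hz => simp only [map_add, hy, hz]; abel
  | ha x z hx hz => simp only [map_add, LinearMap.add_apply, hx, hz]; abel

/-- The bracket of `L` is a bilinear map of complexes. -/
theorem bracket_isPairing : IsPairing 𝔏.d 𝔏.d 𝔏.d 𝔏.sign 𝔏.bracket where
  leibniz := 𝔏.d_bracket
  s_s := 𝔏.sign_sign
  d_s := 𝔏.d_sign

/-- The linear map that sends `x` to the matrix with rows `((-1)^{|x|} x, dx)` and `(0, x)`. -/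
def matrixι : L →ₗ[R] Matrix (Fin 2) (Fin 2) 𝔏.U where
  toFun x := !![𝔏.ι (𝔏.sign x), 𝔏.ι (𝔏.d x); 0, 𝔏.ι x]
  map_add' x y := by ext i j; fin_cases i <;> fin_cases j <;> simp
  map_smul' a x := by ext i j; fin_cases i <;> fin_cases j <;> simp

theorem matrixι_apply (x : L) :
    𝔏.matrixι x = !![𝔏.ι (𝔏.sign x), 𝔏.ι (𝔏.d x); 0, 𝔏.ι x] := rfl

theorem matrixι_isLieMap : 𝔏.IsLieMap 𝔏.matrixι := by
  intro m n x y hx hy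
  have hb := 𝔏.bracket_mem hx hy
  have e1 := 𝔏.ι_bracket (𝔏.d_mem hx) hy
  have e2 := 𝔏.ι_bracket hx (𝔏.d_mem hy)
  have s1 : ksign R ((m - 1) * n) = ksign R (m * n) * ksign R n := by
    rw [sub_mul, one_mul, ksign_sub]
  have s2 : ksign R (m * (n - 1)) = ksign R (m * n) * ksign R m := by
    rw [mul_sub, mul_one, ksign_sub]
  have hm := ksign_mul_self R m
  ext i j
  fin_cases i <;> fin_cases j
  · simpa [matrixι_apply, Matrix.mul_apply, Fin.sum_univ_two] using
      𝔏.ι_sign_isLieMap m n x y hx hy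
  · simp [matrixι_apply, sign_apply _ hx, sign_apply _ hy,
      𝔏.leibniz hx hy, e1, e2, s1, s2, smul_add, smul_sub, smul_smul]
    have : ksign R m * (ksign R (m * n) * ksign R m) = ksign R (m * n) := by
      rw [mul_left_comm, hm, mul_one]
    rw [this]
    abel
  · simp [matrixι_apply]
  · simp [matrixι_apply, ι_bracket _ hx hy]

/-- The algebra morphism that sends `u` to the matrix with rows `((-1)^{|u|} u, du)` and
`(0, u)`. It is multiplicative exactly because `d(uv) = du v + (-1)^{|u|} u dv`. -/
def matrixU : 𝔏.U →ₐ[R] Matrix (Fin 2) (Fin 2) 𝔏.U := lift 𝔏.matrixι 𝔏.matrixι_isLieMap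

/-- The differential of `UL`: the derivation that extends the differential of `L`
(see `dU_ι` and `dU_mul`). -/
def dU : 𝔏.U →ₗ[R] 𝔏.U :=
  Matrix.entryLinearMap R 𝔏.U 0 1 ∘ₗ 𝔏.matrixU.toLinearMap

theorem dU_apply (u : 𝔏.U) : 𝔏.dU u = 𝔏.matrixU u 0 1 := rfl

@[simp]
theorem dU_ι (x : L) : 𝔏.dU (𝔏.ι x) = 𝔏.ι (𝔏.d x) := by
  rw [dU_apply, matrixU, lift_ι, matrixι_apply]; rfl

theorem matrixU_mon {n : ℤ} {u : 𝔏.U} (hu : 𝔏.Mon n u) :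
    𝔏.matrixU u 0 0 = 𝔏.signU u ∧ 𝔏.matrixU u 1 0 = 0 ∧ 𝔏.matrixU u 1 1 = u := by
  induction hu with
  | one => simp
  | mul hx hu ih =>
    obtain ⟨h1, h2, h3⟩ := ih
    have e : ∀ y, 𝔏.matrixU (𝔏.ι y) = 𝔏.matrixι y := fun y => lift_ι _ _ y
    have e' : ∀ y, 𝔏.signU (𝔏.ι y) = 𝔏.ι (𝔏.sign y) := fun y => lift_ι _ _ y
    rw [map_mul, map_mul]
    simp [Matrix.mul_apply, Fin.sum_univ_two, h1, h2, h3, e, e', matrixι_apply]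

theorem matrixU_apply (u : 𝔏.U) :
    𝔏.matrixU u 0 0 = 𝔏.signU u ∧ 𝔏.matrixU u 1 0 = 0 ∧ 𝔏.matrixU u 1 1 = u := by
  induction u using mon_induction with
  | h0 => simp
  | hm n v hv => exact 𝔏.matrixU_mon hv
  | ha v w hv hw => simp [hv, hw]
  | hs a v hv => simp [hv]

theorem dU_mul (u v : 𝔏.U) : 𝔏.dU (u * v) = 𝔏.dU u * v + 𝔏.signU u * 𝔏.dU v := by
  simp only [dU_apply, map_mul, Matrix.mul_apply, Fin.sum_univ_two, 𝔏.matrixU_apply u,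
    𝔏.matrixU_apply v]
  rw [add_comm]

@[simp]
theorem dU_one : 𝔏.dU 1 = 0 := by
  simp [dU_apply]

theorem dU_mem {n : ℤ} {u : 𝔏.U} (hu : u ∈ 𝔏.grU n) : 𝔏.dU u ∈ 𝔏.grU (n - 1) := by
  induction hu using Submodule.span_induction with
  | mem u hu =>
    induction hu with
    | one => simp
    | @mul m n x u hx hu ih =>
      rw [dU_mul, dU_ι, signU_ι hx]
      have h1 := SetLike.mul_mem_graded (ι_mem (𝔏.d_mem hx)) hu.mem
      have h2 := SetLike.mul_mem_graded (ι_mem hx) ih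
      rw [show m - 1 + n = m + n - 1 by ring] at h1
      rw [show m + (n - 1) = m + n - 1 by ring] at h2
      rw [smul_mul_assoc]
      exact add_mem h1 (Submodule.smul_mem _ _ h2)
  | zero => simp
  | add u v _ _ hu hv => rw [map_add]; exact add_mem hu hv
  | smul a u _ hu => rw [map_smul]; exact Submodule.smul_mem _ _ hu

theorem dU_signU (u : 𝔏.U) : 𝔏.dU (𝔏.signU u) = -𝔏.signU (𝔏.dU u) := by
  induction u using mon_induction with
  | h0 => simp
  | hm n v hv =>
    rw [signU_apply hv.mem, map_smul, signU_apply (𝔏.dU_mem hv.mem), ksign_sub, ksign_one]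
    simp
  | ha v w hv hw => simp only [map_add, hv, hw]; abel
  | hs a v hv => simp [hv]

theorem dU_dU (u : 𝔏.U) : 𝔏.dU (𝔏.dU u) = 0 := by
  induction u using mon_induction with
  | h0 => simp
  | hm n v hv =>
    induction hv with
    | one => simp
    | mul hx hu ih => simp [dU_mul, dU_signU, 𝔏.d_d, ih, signU_signU]
  | ha v w hv hw => simp [hv, hw]
  | hs a v hv => simp [hv]

/-- The multiplication of `UL` is a bilinear map of complexes. -/
theorem mul_isPairing :
    IsPairing 𝔏.dU 𝔏.dU 𝔏.dU 𝔏.signU.toLinearMap (LinearMap.mul R 𝔏.U) where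
  leibniz := 𝔏.dU_mul
  s_s := signU_signU
  d_s := 𝔏.dU_signU

/-- The differential `d(a ⊗ b) = da ⊗ b + (-1)^{|a|} a ⊗ db` of `UL ⊗ UL`. -/
def dUU : 𝔏.UU →ₗ[R] 𝔏.UU :=
  (GradedTensorProduct.of R 𝔏.grU 𝔏.grU).toLinearMap ∘ₗ
    (TensorProduct.map 𝔏.dU LinearMap.id + TensorProduct.map 𝔏.signU.toLinearMap 𝔏.dU) ∘ₗ
      (GradedTensorProduct.of R 𝔏.grU 𝔏.grU).symm.toLinearMap

/-- The bilinear map `(a, b) ↦ a ⊗ b`. -/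
def tmulU : 𝔏.U →ₗ[R] 𝔏.U →ₗ[R] 𝔏.UU :=
  (TensorProduct.mk R 𝔏.U 𝔏.U).compr₂ (GradedTensorProduct.of R 𝔏.grU 𝔏.grU).toLinearMap

theorem tmulU_apply (a b : 𝔏.U) : 𝔏.tmulU a b = GradedTensorProduct.tmul R a b := rfl

theorem dUU_tmulU (a b : 𝔏.U) :
    𝔏.dUU (𝔏.tmulU a b) = 𝔏.tmulU (𝔏.dU a) b + 𝔏.tmulU (𝔏.signU a) (𝔏.dU b) := rfl

theorem tmulU_ext {M : Type*} [AddCommGroup M] [Module R M] {f g : 𝔏.UU →ₗ[R] M}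
    (h : ∀ m n a b, 𝔏.Mon m a → 𝔏.Mon n b → f (𝔏.tmulU a b) = g (𝔏.tmulU a b)) : f = g := by
  apply GradedTensorProduct.hom_ext
  apply TensorProduct.ext
  apply mon_linearMap_ext
  intro m a ha
  apply mon_linearMap_ext
  intro n b hb
  exact h m n a b ha hb

theorem dUU_dUU (t : 𝔏.UU) : 𝔏.dUU (𝔏.dUU t) = 0 := by
  have : 𝔏.dUU ∘ₗ 𝔏.dUU = 0 := by
    apply 𝔏.tmulU_ext
    intro m n a b _ _
    simp [dUU_tmulU, dU_dU, dU_signU]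
  exact LinearMap.congr_fun this t

theorem tmulU_isPairing :
    IsPairing 𝔏.dU 𝔏.dU 𝔏.dUU 𝔏.signU.toLinearMap 𝔏.tmulU where
  leibniz := 𝔏.dUU_tmulU
  s_s := signU_signU
  d_s := 𝔏.dU_signU

theorem tmulU_mul_tmulU {m n : ℤ} (a : 𝔏.U) {b a' : 𝔏.U} (b' : 𝔏.U) (hb : b ∈ 𝔏.grU m)
    (ha' : a' ∈ 𝔏.grU n) :
    𝔏.tmulU a b * 𝔏.tmulU a' b' = ksign R (m * n) • 𝔏.tmulU (a * a') (b * b') :=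
  tmul_mul_tmul _ a b' hb ha'

/-- Left multiplication by `x ⊗ 1 + 1 ⊗ x` satisfies the Leibniz rule. -/
theorem dUU_primitive_mul {n : ℤ} {x : L} (hx : x ∈ 𝔏.gr n) (t : 𝔏.UU) :
    𝔏.dUU (𝔏.primitiveι x * t) =
      𝔏.primitiveι (𝔏.d x) * t + ksign R n • (𝔏.primitiveι x * 𝔏.dUU t) := by
  have : 𝔏.dUU ∘ₗ LinearMap.mulLeft R (𝔏.primitiveι x) =
      LinearMap.mulLeft R (𝔏.primitiveι (𝔏.d x)) +
        ksign R n • (LinearMap.mulLeft R (𝔏.primitiveι x) ∘ₗ 𝔏.dUU) := by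
    apply 𝔏.tmulU_ext
    intro k l a b ha hb
    have h1 := 𝔏.one_mem_grU
    have hx' := ι_mem hx
    have hdx := ι_mem (𝔏.d_mem hx)
    have ha' := ha.mem
    have hda := 𝔏.dU_mem ha'
    have e : ∀ y : L, 𝔏.primitiveι y = 𝔏.tmulU (𝔏.ι y) 1 + 𝔏.tmulU 1 (𝔏.ι y) := fun y => rfl
    simp only [LinearMap.comp_apply, LinearMap.add_apply, LinearMap.smul_apply,
      LinearMap.mulLeft_apply, e, dUU_tmulU, mul_add, add_mul, signU_apply ha', map_smul,
      LinearMap.smul_apply, mul_smul_comm]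
    rw [𝔏.tmulU_mul_tmulU _ _ h1 ha', 𝔏.tmulU_mul_tmulU _ _ hx' ha',
      𝔏.tmulU_mul_tmulU _ _ h1 ha', 𝔏.tmulU_mul_tmulU _ _ hdx ha',
      𝔏.tmulU_mul_tmulU _ _ h1 hda, 𝔏.tmulU_mul_tmulU _ _ hx' hda,
      𝔏.tmulU_mul_tmulU _ _ h1 ha', 𝔏.tmulU_mul_tmulU _ _ hx' ha']
    have s1 : ksign R ((n - 1) * k) = ksign R (n * k) * ksign R k := by
      rw [sub_mul, one_mul, ksign_sub]
    have s2 : ksign R (n * (k - 1)) = ksign R (n * k) * ksign R n := by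
      rw [mul_sub, mul_one, ksign_sub]
    have s3 : ksign R n * (ksign R (n * k) * ksign R n) = ksign R (n * k) := by
      rw [mul_left_comm, ksign_mul_self, mul_one]
    simp only [zero_mul, ksign_zero, one_smul, one_mul, map_smul, map_add, dUU_tmulU, dU_mul,
      dU_ι, signU_ι hx, signU_apply ha', map_mul, smul_mul_assoc, mul_smul_comm, smul_add,
      smul_smul, s1, s2, s3, LinearMap.smul_apply, LinearMap.add_apply]
    module
  exact LinearMap.congr_fun this t

/-- The diagonal is a chain map. -/
theorem dUU_diag (u : 𝔏.U) : 𝔏.dUU (𝔏.diag u) = 𝔏.diag (𝔏.dU u) := by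
  induction u using mon_induction with
  | h0 => simp
  | hm n v hv =>
    induction hv with
    | one =>
      rw [map_one, dU_one, map_zero]
      change 𝔏.dUU (𝔏.tmulU 1 1) = 0
      simp [dUU_tmulU]
    | mul hx hu ih =>
      have e : ∀ y : L, 𝔏.diag (𝔏.ι y) = 𝔏.primitiveι y := fun y => by simp [diag]
      rw [map_mul, e, 𝔏.dUU_primitive_mul hx, ih, dU_mul, map_add, map_mul, map_mul, dU_ι, e,
        signU_ι hx, map_smul, e, smul_mul_assoc]
  | ha v w hv hw => simp [hv, hw]
  | hs a v hv => simp [hv]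

/-! ### The free parts of the homology of `L` and of `UL` -/

/-- `F H(L)`. -/
abbrev FH : Type _ := FreeHomology 𝔏.d

/-- `F H(UL)`. -/
abbrev FHU : Type _ := FreeHomology 𝔏.dU

/-- `F H(UL ⊗ UL)`. -/
abbrev FHUU : Type _ := FreeHomology 𝔏.dUU

/-- The Lie bracket of `F H(L)`, `[[x], [y]] = [[x, y]]`. -/
def bracketFH : 𝔏.FH →ₗ[R] 𝔏.FH →ₗ[R] 𝔏.FH := map₂ 𝔏.bracket_isPairing

/-- The product of `F H(UL)`. -/
def mulFHU : 𝔏.FHU →ₗ[R] 𝔏.FHU →ₗ[R] 𝔏.FHU := map₂ 𝔏.mul_isPairing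

/-- The unit of `F H(UL)`. -/
def oneFHU : 𝔏.FHU := FreeHomology.mk 𝔏.dU ⟨1, by simp⟩

/-- The elements of degree `n` of `F H(L)`. -/
def grFH (n : ℤ) : Submodule R 𝔏.FH := part 𝔏.d (𝔏.gr n)

/-- The elements of degree `n` of `F H(UL)`. -/
def grFHU (n : ℤ) : Submodule R 𝔏.FHU := part 𝔏.dU (𝔏.grU n)

/-- The map `F H(L) → F H(UL)` induced by the canonical map `L → UL`. -/
def ιFH : 𝔏.FH →ₗ[R] 𝔏.FHU := FreeHomology.map 𝔏.ι 𝔏.dU_ι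

/-- The map `F H(Δ) : F H(UL) → F H(UL ⊗ UL)` induced by the diagonal. -/
def diagFH : 𝔏.FHU →ₗ[R] 𝔏.FHUU := FreeHomology.map 𝔏.diag.toLinearMap 𝔏.dUU_diag

/-- The Künneth map `F κ : F H(UL) ⊗ F H(UL) → F H(UL ⊗ UL)`, `[x] ⊗ [y] ↦ [x ⊗ y]`. -/
def kunneth : 𝔏.FHU ⊗[R] 𝔏.FHU →ₗ[R] 𝔏.FHUU := TensorProduct.lift (map₂ 𝔏.tmulU_isPairing)

theorem exists_functional [IsDomain R] [IsPrincipalIdealRing R]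
    (f : 𝔏.FHU →ₗ[R] FractionRing R) : ∃ φ : 𝔏.U →ₗ[R] FractionRing R,
      (∀ u, φ (𝔏.dU u) = 0) ∧ ∀ z : LinearMap.ker 𝔏.dU, φ z = f (FreeHomology.mk 𝔏.dU z) := by
  obtain ⟨φ, hφ⟩ := (baer_fractionRing R).extension_property (LinearMap.ker 𝔏.dU).subtype
    (Submodule.injective_subtype _) (f ∘ₗ FreeHomology.mk 𝔏.dU)
  have h : ∀ z : LinearMap.ker 𝔏.dU, φ z = f (FreeHomology.mk 𝔏.dU z) :=
    fun z => LinearMap.congr_fun hφ z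
  refine ⟨φ, fun u => ?_, h⟩
  rw [h ⟨𝔏.dU u, 𝔏.dU_dU u⟩, mk_eq_zero_of_boundary _ rfl, map_zero]

/-- Over a principal ideal domain the Künneth map is injective: the equation that defines the
primitive elements determines the diagonal of `x` as the element `x ⊗ 1 + 1 ⊗ x`. -/
theorem kunneth_injective [IsDomain R] [IsPrincipalIdealRing R] :
    Function.Injective 𝔏.kunneth := by
  rw [injective_iff_map_eq_zero]
  intro t ht
  have : Module.IsTorsionFree R 𝔏.FHU :=
    Submodule.isTorsionFree_iff_torsion_eq_bot.2 Submodule.QuotientTorsion.torsion_eq_bot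
  apply tensor_eq_zero
  intro f g
  obtain ⟨φ, hφ, hφ'⟩ := 𝔏.exists_functional f
  obtain ⟨ψ, hψ, hψ'⟩ := 𝔏.exists_functional g
  let F : 𝔏.UU →ₗ[R] FractionRing R := LinearMap.mul' R _ ∘ₗ TensorProduct.map φ ψ ∘ₗ
    (GradedTensorProduct.of R 𝔏.grU 𝔏.grU).symm.toLinearMap
  have hF : ∀ a b, F (𝔏.tmulU a b) = φ a * ψ b := fun _ _ => rfl
  have hFd : F ∘ₗ 𝔏.dUU = 0 := by
    apply 𝔏.tmulU_ext
    intro m n a b _ _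
    simp [dUU_tmulU, hF, hφ, hψ]
  let G : 𝔏.FHUU →ₗ[R] FractionRing R :=
    FreeHomology.lift (F ∘ₗ (LinearMap.ker 𝔏.dUU).subtype)
      (fun a ha x hx => (smul_eq_zero.1 hx).resolve_left (nonZeroDivisors.ne_zero ha))
      (fun z w hz => by simpa [hz] using LinearMap.congr_fun hFd w)
  have hG : G ∘ₗ 𝔏.kunneth = LinearMap.mul' R _ ∘ₗ TensorProduct.map f g := by
    apply TensorProduct.ext'
    intro x y
    obtain ⟨x, rfl⟩ := mk_surjective _ x
    obtain ⟨y, rfl⟩ := mk_surjective _ y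
    simp only [LinearMap.comp_apply, kunneth, TensorProduct.lift.tmul, TensorProduct.map_tmul,
      LinearMap.mul'_apply, map₂_mk, G, lift_mk, ← hφ', ← hψ']
    exact hF _ _
  have := LinearMap.congr_fun hG t
  rw [LinearMap.comp_apply, ht, map_zero] at this
  exact this.symm

/-- The submodule `P` of primitive elements of the Hopf algebra `F H(UL)`. The diagonal of
`F H(UL)` is `(F κ)⁻¹ ∘ F H(Δ)`, so `x` is primitive when `F H(Δ)(x) = F κ(x ⊗ 1 + 1 ⊗ x)`. -/
def primitives : Submodule R 𝔏.FHU :=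
  LinearMap.eqLocus 𝔏.diagFH
    (𝔏.kunneth ∘ₗ
      ((TensorProduct.mk R 𝔏.FHU 𝔏.FHU).flip 𝔏.oneFHU + TensorProduct.mk R 𝔏.FHU 𝔏.FHU 𝔏.oneFHU))

theorem mem_primitives (x : 𝔏.FHU) :
    x ∈ 𝔏.primitives ↔ 𝔏.diagFH x = 𝔏.kunneth (x ⊗ₜ 𝔏.oneFHU + 𝔏.oneFHU ⊗ₜ x) := Iff.rfl

end DGLieAlgebra

end

/-! The proof rests on a chain endomorphism of `UL` whose eigenvalues record word length: the
convolution square `ψ`, which is the diagonal followed by the multiplication. Modulo shorter words,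
`ψ` multiplies a product of `p` elements of `L` by `2 ^ p` (`Word.convSq_sub_mem`), and on `L` it is
exactly multiplication by `2`. On words of length at most `p + 1`, the composite of the maps `ψ - 2
^ i` for `i = 0, 2, ..., p + 1` therefore lands in `L`, and on `L` it is a scalar `c`, nonzero in
characteristic zero (`lieProj_mem_range`, `lieProj_ι`, `lieScalar_ne_zero`). This plays the part of
a projection onto `L`, without denominators and without a Poincaré-Birkhoff-Witt basis.

Injectivity on `FH`: if a multiple of a cycle of `L` bounds in `UL`, the projection moves the
bounding chain into `L`, at the price of the factor `c`. Cokernel: multiplying out the equation for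
a primitive class shows that `ψ` acts on it as `2`, up to torsion. The projection thus acts on it as
`c`, and its value is represented by a cycle of `L`.

Both arguments descend from `UL` to `L` through the injectivity of `ι` (`ι_injective`). It is
detected by a representation of `L`: the adjoint action, enlarged by the degree derivation, is
faithful because all degrees are positive. Closure of the primitives under commutators follows from
the Leibniz rule on `UL ⊗ UL` (`dUU_mul`). -/

noncomputable section

open scoped TensorProduct DirectSum

namespace GrLieAlgebra

variable {R L : Type*} [CommRing R] [AddCommGroup L] [Module R L] (𝔤 : GrLieAlgebra R L)

/-! ### Injectivity of the canonical map `L → UL` -/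

/-- The degree derivation `x ↦ |x| x` of `L`. -/
def degreeMap : L →ₗ[R] L := 𝔤.ofParts fun n => (n : R) • (𝔤.gr n).subtype

theorem degreeMap_apply {n : ℤ} {x : L} (hx : x ∈ 𝔤.gr n) : 𝔤.degreeMap x = (n : R) • x := by
  rw [degreeMap, ofParts_apply 𝔤 _ hx]; rfl

/-- The adjoint action of `L` on the semidirect product of `L` with its degree derivation. -/
def extendedAd : L →ₗ[R] Module.End R (L × R) :=
  LinearMap.mk₂ R (fun x p => (𝔤.bracket x p.1 - p.2 • 𝔤.degreeMap x, 0))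
    (fun x y p => by ext <;> simp [smul_add]; abel)
    (fun c x p => by ext <;> simp [smul_sub, smul_comm c])
    (fun x p q => by ext <;> simp [add_smul]; abel)
    (fun c x p => by ext <;> simp [smul_sub, mul_smul])

theorem extendedAd_apply (x : L) (p : L × R) :
    𝔤.extendedAd x p = (𝔤.bracket x p.1 - p.2 • 𝔤.degreeMap x, 0) := rfl

/-- The pair `(z, r)` stands for `z + r D`, where `D` is the degree derivation and `[x, D] = -|x|
x`. In the variable `z` the condition is the Jacobi identity; in the variable `r` it says that `D`
is a derivation of the bracket. -/
theorem extendedAd_isLieMap : 𝔤.IsLieMap 𝔤.extendedAd := by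
  intro m n x y hx hy
  apply LinearMap.ext
  rintro ⟨z, r⟩
  have hj : 𝔤.bracket x (𝔤.bracket y z) =
      𝔤.bracket (𝔤.bracket x y) z + ksign R (m * n) • 𝔤.bracket y (𝔤.bracket x z) := by
    induction z using 𝔤.hom_induction with
    | h0 => simp
    | hh k z hz => exact 𝔤.jacobi hx hy hz
    | ha z w hz hw => simp only [map_add, hz, hw, smul_add]; abel
  have ha := 𝔤.antisymm hx hy
  simp only [LinearMap.sub_apply, LinearMap.smul_apply, Module.End.mul_apply, extendedAd_apply,
    degreeMap_apply 𝔤 hx, degreeMap_apply 𝔤 hy, degreeMap_apply 𝔤 (𝔤.bracket_mem hx hy),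
    map_sub, map_smul, hj, zero_smul, sub_zero, Prod.smul_mk, Prod.mk_sub_mk, smul_zero,
    Int.cast_add]
  congr 1
  -- Antisymmetry merges the two terms containing `r` into `-r (m + n) [x, y]`.
  have hb : ksign R (m * n) • 𝔤.bracket y x = - 𝔤.bracket x y := by rw [ha, neg_neg]
  rw [smul_sub, smul_comm _ r, smul_comm _ (m : R) (𝔤.bracket y x), hb]
  module

theorem degreeMap_injective [IsDomain R] [CharZero R] (hconn : 𝔤.Connected)
    (htf : ∀ n, Module.IsTorsionFree R (𝔤.gr n)) {x : L} (hx : 𝔤.degreeMap x = 0) : x = 0 := by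
  classical
  have key : ∀ (y : L) (n : ℤ), (DirectSum.decompose 𝔤.gr (𝔤.degreeMap y) n : 𝔤.gr n) =
      (n : R) • DirectSum.decompose 𝔤.gr y n := by
    intro y n
    induction y using 𝔤.hom_induction with
    | h0 => simp
    | hh k z hz =>
      rw [degreeMap_apply 𝔤 hz, DirectSum.decompose_smul, DirectSum.smul_apply]
      by_cases h : k = n
      · rw [h]
      · rw [DirectSum.decompose_of_mem _ hz, DirectSum.of_eq_of_ne _ _ _ (Ne.symm h)]
        simp
    | ha y z hy hz => simp [hy, hz]
  apply (DirectSum.decompose 𝔤.gr).injective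
  rw [DirectSum.decompose_zero]
  refine DFinsupp.ext fun n => ?_
  have h := key x n
  rw [hx, DirectSum.decompose_zero] at h
  -- Components in degrees `n ≤ 0` vanish by connectedness; for `n > 0` the integer `n` is nonzero
  -- in `R` and can be cancelled.
  rcases le_or_gt n 0 with hn | hn
  · have := (DirectSum.decompose 𝔤.gr x n).2
    exact Subtype.ext ((Submodule.mem_bot R).1 (hconn n hn ▸ this))
  · have := htf n
    exact (smul_eq_zero.1 h.symm).resolve_left (by exact_mod_cast hn.ne')

/-- A connected graded Lie algebra without torsion over a domain of characteristic zero embeds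
into its universal enveloping algebra. -/
theorem ι_injective [IsDomain R] [CharZero R] (hconn : 𝔤.Connected)
    (htf : ∀ n, Module.IsTorsionFree R (𝔤.gr n)) : Function.Injective 𝔤.ι := by
  rw [injective_iff_map_eq_zero]
  intro x hx
  apply 𝔤.degreeMap_injective hconn htf
  have h := lift_ι _ 𝔤.extendedAd_isLieMap x
  rw [hx, map_zero] at h
  -- The vector `(0, 1)` is `D` itself, on which `x` acts as minus the degree map; the plain adjoint
  -- action would lose the centre.
  have h' := congrArg Prod.fst (LinearMap.congr_fun h (0, 1))
  simpa [extendedAd_apply] using h'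

/-! ### The squaring operation and the word length filtration -/

/-- The multiplication `UL ⊗ UL → UL`, as a linear map. -/
def mulUU : 𝔤.UU →ₗ[R] 𝔤.U :=
  LinearMap.mul' R 𝔤.U ∘ₗ (GradedTensorProduct.of R 𝔤.grU 𝔤.grU).symm.toLinearMap

theorem mulUU_tmul (a b : 𝔤.U) : 𝔤.mulUU (GradedTensorProduct.tmul R a b) = a * b := rfl

/-- The convolution square `u ↦ ∑ u' u''` of the identity of `UL`. -/
def convSq : 𝔤.U →ₗ[R] 𝔤.U := 𝔤.mulUU ∘ₗ 𝔤.diag.toLinearMap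

theorem diag_ι (x : L) : 𝔤.diag (𝔤.ι x) = 𝔤.primitiveι x := lift_ι _ _ x

theorem convSq_one : 𝔤.convSq 1 = 1 := by
  simp only [convSq, LinearMap.comp_apply, AlgHom.toLinearMap_apply, map_one]
  exact (𝔤.mulUU_tmul 1 1).trans (one_mul 1)

theorem convSq_ι (x : L) : 𝔤.convSq (𝔤.ι x) = 𝔤.ι x + 𝔤.ι x := by
  simp only [convSq, LinearMap.comp_apply, AlgHom.toLinearMap_apply, diag_ι, primitiveι_apply,
    map_add, mulUU_tmul, mul_one, one_mul]

/-- `Word p n u`: the element `u` of `UL` is a product of `p` homogeneous elements of `L` whose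
degrees add up to `n`. -/
inductive Word : ℕ → ℤ → 𝔤.U → Prop
  | one : Word 0 0 1
  | mul {p : ℕ} {m n : ℤ} {x : L} {u : 𝔤.U} :
      x ∈ 𝔤.gr m → Word p n u → Word (p + 1) (m + n) (𝔤.ι x * u)

/-- The part of `UL` that is spanned by the products of at most `p` elements of `L`. -/
def wordFil (p : ℕ) : Submodule R 𝔤.U := Submodule.span R {u | ∃ q ≤ p, ∃ n, 𝔤.Word q n u}

/-- The filtration of `UL ⊗ UL` induced by the word length. -/
def wordFilUU (p : ℕ) : Submodule R 𝔤.UU :=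
  Submodule.span R {t | ∃ i j m n a b, i + j = p ∧ 𝔤.Word i m a ∧ 𝔤.Word j n b ∧
    t = GradedTensorProduct.tmul R a b}

variable {𝔤}

theorem Word.mon {p : ℕ} {n : ℤ} {u : 𝔤.U} (h : 𝔤.Word p n u) : 𝔤.Mon n u := by
  induction h with
  | one => exact Mon.one
  | mul hx _ ih => exact Mon.mul hx ih

theorem Word.mem_wordFil {p : ℕ} {n : ℤ} {u : 𝔤.U} (h : 𝔤.Word p n u) : u ∈ 𝔤.wordFil p :=
  Submodule.subset_span ⟨p, le_rfl, n, h⟩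

theorem Word.mul' {p q : ℕ} {m n : ℤ} {u v : 𝔤.U} (hu : 𝔤.Word p m u) (hv : 𝔤.Word q n v) :
    𝔤.Word (p + q) (m + n) (u * v) := by
  induction hu with
  | one => simpa using hv
  | @mul p m' _ _ _ hx _ ih =>
    rw [mul_assoc, add_assoc m', Nat.add_right_comm p 1 q]
    exact Word.mul hx ih

theorem wordFil_mono {p q : ℕ} (h : p ≤ q) : 𝔤.wordFil p ≤ 𝔤.wordFil q :=
  Submodule.span_mono fun _ ⟨r, hr, hu⟩ => ⟨r, hr.trans h, hu⟩

theorem mul_mem_wordFil {p q : ℕ} {u v : 𝔤.U} (hu : u ∈ 𝔤.wordFil p) (hv : v ∈ 𝔤.wordFil q) :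
    u * v ∈ 𝔤.wordFil (p + q) := by
  have h : 𝔤.wordFil p * 𝔤.wordFil q ≤ 𝔤.wordFil (p + q) := by
    rw [wordFil, wordFil, Submodule.span_mul_span, Submodule.span_le]
    rintro _ ⟨a, ⟨i, hi, m, ha⟩, b, ⟨j, hj, n, hb⟩, rfl⟩
    exact Submodule.subset_span ⟨i + j, add_le_add hi hj, _, ha.mul' hb⟩
  exact h (Submodule.mul_mem_mul hu hv)

theorem ι_mem_wordFil {n : ℤ} {x : L} (hx : x ∈ 𝔤.gr n) : 𝔤.ι x ∈ 𝔤.wordFil 1 := by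
  simpa using (Word.mul hx Word.one).mem_wordFil

/-- The graded commutator with an element of `L` does not increase the word length. -/
theorem commutator_mem_wordFil {m n : ℤ} {p : ℕ} {x : L} {a : 𝔤.U} (hx : x ∈ 𝔤.gr m)
    (ha : 𝔤.Word p n a) :
    𝔤.ι x * a - ksign R (m * n) • (a * 𝔤.ι x) ∈ 𝔤.wordFil p := by
  induction ha with
  | one => simp [ksign_zero]
  | @mul p k n y a hy ha ih =>
    -- The graded commutator with `x` is a derivation. It replaces one letter `y` by the single
    -- letter `[x, y]`, so the length does not grow.
    have e : 𝔤.ι x * (𝔤.ι y * a) - ksign R (m * (k + n)) • (𝔤.ι y * a * 𝔤.ι x) =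
        𝔤.ι (𝔤.bracket x y) * a +
          ksign R (m * k) • (𝔤.ι y * (𝔤.ι x * a - ksign R (m * n) • (a * 𝔤.ι x))) := by
      simp only [ι_bracket 𝔤 hx hy, mul_add, ksign_add, sub_mul, mul_sub, smul_sub, smul_smul,
        smul_mul_assoc, mul_smul_comm, mul_assoc]
      abel
    rw [e]
    refine add_mem ?_ (Submodule.smul_mem _ _ ?_)
    · rw [add_comm p]
      exact mul_mem_wordFil (ι_mem_wordFil (𝔤.bracket_mem hx hy)) ha.mem_wordFil
    · rw [add_comm p]
      exact mul_mem_wordFil (ι_mem_wordFil hy) ih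

theorem primitiveι_mul_mem {m : ℤ} {p : ℕ} {x : L} {t : 𝔤.UU} (hx : x ∈ 𝔤.gr m)
    (ht : t ∈ 𝔤.wordFilUU p) : 𝔤.primitiveι x * t ∈ 𝔤.wordFilUU (p + 1) := by
  induction ht using Submodule.span_induction with
  | zero => simp
  | add s t _ _ hs ht => rw [mul_add]; exact add_mem hs ht
  | smul c t _ ht => rw [mul_smul_comm]; exact Submodule.smul_mem _ _ ht
  | mem t ht =>
    obtain ⟨i, j, k, n, a, b, hij, ha, hb, rfl⟩ := ht
    rw [primitiveι_apply, add_mul, tmul_mul_tmul 𝔤 _ _ 𝔤.one_mem_grU ha.mon.mem,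
      tmul_mul_tmul 𝔤 _ _ (ι_mem hx) ha.mon.mem, one_mul, one_mul]
    refine add_mem (Submodule.smul_mem _ _ (Submodule.subset_span ?_))
      (Submodule.smul_mem _ _ (Submodule.subset_span ?_))
    · exact ⟨i + 1, j, _, _, _, _, by omega, Word.mul hx ha, hb, rfl⟩
    · exact ⟨i, j + 1, _, _, _, _, by omega, ha, Word.mul hx hb, rfl⟩

theorem Word.diag_mem {p : ℕ} {n : ℤ} {u : 𝔤.U} (h : 𝔤.Word p n u) :
    𝔤.diag u ∈ 𝔤.wordFilUU p := by
  induction h with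
  | one =>
    rw [map_one]
    exact Submodule.subset_span ⟨0, 0, 0, 0, 1, 1, rfl, Word.one, Word.one, rfl⟩
  | mul hx _ ih => rw [map_mul, diag_ι]; exact primitiveι_mul_mem hx ih

/-- On `a ⊗ b` the two summands of `x ⊗ 1 + 1 ⊗ x` contribute `x a b` and `± a x b`. Moving `x` to
the front of the second costs a commutator, which has no more letters than `a`. -/
theorem mulUU_primitiveι_mul {m : ℤ} {p : ℕ} {x : L} {t : 𝔤.UU} (hx : x ∈ 𝔤.gr m)
    (ht : t ∈ 𝔤.wordFilUU p) :
    𝔤.mulUU (𝔤.primitiveι x * t) - (2 : R) • (𝔤.ι x * 𝔤.mulUU t) ∈ 𝔤.wordFil p := by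
  induction ht using Submodule.span_induction with
  | zero => simp
  | add s t _ _ hs ht =>
    have := add_mem hs ht
    rw [mul_add, map_add, map_add, mul_add, smul_add]
    convert this using 1
    abel
  | smul c t _ ht =>
    have := Submodule.smul_mem _ c ht
    rwa [mul_smul_comm, map_smul, map_smul, mul_smul_comm, smul_comm, ← smul_sub]
  | mem t ht =>
    obtain ⟨i, j, k, n, a, b, hij, ha, hb, rfl⟩ := ht
    rw [primitiveι_apply, add_mul, tmul_mul_tmul 𝔤 _ _ 𝔤.one_mem_grU ha.mon.mem,
      tmul_mul_tmul 𝔤 _ _ (ι_mem hx) ha.mon.mem, one_mul, one_mul, map_add, map_smul, map_smul,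
      mulUU_tmul, mulUU_tmul, mulUU_tmul, zero_mul, ksign_zero, one_smul]
    have := neg_mem (mul_mem_wordFil (commutator_mem_wordFil hx ha) hb.mem_wordFil)
    rw [hij, sub_mul, smul_mul_assoc, mul_assoc, mul_assoc] at this
    convert this using 1
    rw [two_smul, mul_assoc]
    abel

/-- On products of `p` elements of `L` the convolution square of the identity is multiplication
by `2 ^ p`, up to products of fewer elements. -/
theorem Word.convSq_sub_mem {p : ℕ} {n : ℤ} {u : 𝔤.U} (h : 𝔤.Word (p + 1) n u) :
    𝔤.convSq u - (2 ^ (p + 1) : R) • u ∈ 𝔤.wordFil p := by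
  induction p generalizing n u with
  | zero =>
    obtain _ | @⟨_, m, k, x, v, hx, hv⟩ := h
    cases hv
    rw [mul_one, convSq_ι, ← two_smul R]
    simp
  | succ p ih =>
    obtain _ | @⟨_, m, k, x, v, hx, hv⟩ := h
    -- `ψ(x v)` agrees with `2 x ψ(v)` up to shorter words, and by induction `ψ(v)` agrees with `2 ^
    -- (p + 1) v`.
    have h1 := mulUU_primitiveι_mul hx hv.diag_mem
    have h2 := Submodule.smul_mem _ (2 : R) (mul_mem_wordFil (ι_mem_wordFil hx) (ih hv))
    rw [add_comm 1 p] at h2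
    have h3 := add_mem h1 h2
    convert h3 using 1
    have e : 𝔤.convSq (𝔤.ι x * v) = 𝔤.mulUU (𝔤.primitiveι x * 𝔤.diag v) := by
      simp [convSq, diag_ι]
    have e' : 𝔤.convSq v = 𝔤.mulUU (𝔤.diag v) := rfl
    rw [e, e', mul_sub, mul_smul_comm, smul_sub, smul_smul, ← pow_succ']
    abel

theorem convSq_sub_mem {p : ℕ} {u : 𝔤.U} (h : u ∈ 𝔤.wordFil (p + 1)) :
    𝔤.convSq u - (2 ^ (p + 1) : R) • u ∈ 𝔤.wordFil p := by
  induction h using Submodule.span_induction with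
  | zero => simp
  | add u v _ _ hu hv =>
    have := add_mem hu hv
    rw [map_add, smul_add]
    convert this using 1
    abel
  | smul c t _ ht =>
    have := Submodule.smul_mem _ c ht
    rwa [map_smul, smul_comm, ← smul_sub]
  | mem u hu =>
    obtain ⟨q, hq, n, hu⟩ := hu
    obtain rfl | hlt := hq.eq_or_lt
    · exact hu.convSq_sub_mem
    · have hq' : q ≤ p := by omega
      -- For words that are already short no eigenvalue matters: it is enough that `ψ` preserves the
      -- filtration.
      have : ∀ {q n} {u : 𝔤.U}, 𝔤.Word q n u → 𝔤.convSq u ∈ 𝔤.wordFil q := by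
        intro q n u hu
        cases q with
        | zero => cases hu; rw [convSq_one]; exact Word.one.mem_wordFil
        | succ q =>
          have h := add_mem (wordFil_mono q.le_succ hu.convSq_sub_mem)
            (Submodule.smul_mem _ (2 ^ (q + 1) : R) hu.mem_wordFil)
          rwa [sub_add_cancel] at h
      exact wordFil_mono hq' (sub_mem (this hu) (Submodule.smul_mem _ _ hu.mem_wordFil))

theorem exists_mem_wordFil (u : 𝔤.U) : ∃ p, u ∈ 𝔤.wordFil p := by
  induction u using mon_induction with
  | h0 => exact ⟨0, zero_mem _⟩
  | hm n v hv =>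
    suffices ∃ p, 𝔤.Word p n v from this.imp fun _ h => h.mem_wordFil
    induction hv with
    | one => exact ⟨0, Word.one⟩
    | mul hx _ ih => exact ih.imp' (· + 1) fun _ h => Word.mul hx h
  | ha v w hv hw =>
    obtain ⟨p, hp⟩ := hv
    obtain ⟨q, hq⟩ := hw
    exact ⟨max p q, add_mem (wordFil_mono (le_max_left _ _) hp)
      (wordFil_mono (le_max_right _ _) hq)⟩
  | hs a v hv => exact hv.imp fun _ h => Submodule.smul_mem _ _ h

/-- Words of length at most one are scalars and elements of `L`; `ψ - 1` kills the former and fixes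
the latter. -/
theorem convSq_sub_one_mem_range {u : 𝔤.U} (h : u ∈ 𝔤.wordFil 1) :
    𝔤.convSq u - u ∈ LinearMap.range 𝔤.ι := by
  induction h using Submodule.span_induction with
  | zero => simp
  | add u v _ _ hu hv =>
    have := add_mem hu hv
    rw [map_add]
    convert this using 1
    abel
  | smul c t _ ht =>
    have := Submodule.smul_mem _ c ht
    rwa [map_smul, ← smul_sub]
  | mem u hu =>
    obtain ⟨q, hq, n, hu⟩ := hu
    cases hu with
    | one => simp [convSq_one]
    | mul hx hv =>
      cases hv with
      | one => rw [mul_one, convSq_ι]; simp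
      | mul => omega

/-! ### The projection onto `L` up to a scalar -/

variable (𝔤)

/-- A multiple of the projection of the products of at most `p + 1` elements of `L` onto `L`:
the composite of the maps `ψ - 2 ^ i` for `i = 0, 2, 3, …, p + 1`, where `ψ` is the convolution
square of the identity. -/
def lieProj : ℕ → Module.End R 𝔤.U
  | 0 => 𝔤.convSq - 1
  | p + 1 => lieProj p * (𝔤.convSq - (2 ^ (p + 2) : R) • 1)

/-- The factor by which `lieProj p` multiplies the elements of `L`. -/
def lieScalar (R : Type*) [CommRing R] : ℕ → R
  | 0 => 1
  | p + 1 => lieScalar R p * (2 - 2 ^ (p + 2))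

theorem lieScalar_ne_zero [IsDomain R] [CharZero R] (p : ℕ) : lieScalar R p ≠ 0 := by
  induction p with
  | zero => exact one_ne_zero
  | succ p ih =>
    -- The exponents start at `2`, so the factor `2 - 2 ^ 1 = 0` never occurs.
    refine mul_ne_zero ih (sub_ne_zero.2 ?_)
    have : 2 ≠ 2 ^ (p + 2) := by
      rw [pow_succ]
      have := Nat.one_lt_two_pow (Nat.succ_ne_zero p)
      omega
    exact_mod_cast this

theorem lieProj_ι (p : ℕ) (x : L) : 𝔤.lieProj p (𝔤.ι x) = lieScalar R p • 𝔤.ι x := by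
  induction p with
  | zero => simp [lieProj, lieScalar, convSq_ι]
  | succ p ih =>
    have : (𝔤.convSq - (2 ^ (p + 2) : R) • (1 : Module.End R 𝔤.U)) (𝔤.ι x) =
        (2 - 2 ^ (p + 2) : R) • 𝔤.ι x := by
      simp [convSq_ι, sub_smul, two_smul]
    rw [lieProj, Module.End.mul_apply, this, map_smul, ih, lieScalar, smul_smul, mul_comm]

variable {𝔤}

/-- Each factor `ψ - 2 ^ i` with `i ≥ 2` shortens words by one letter, down to length one; the last
factor `ψ - 1` then removes the constants. -/
theorem lieProj_mem_range {p : ℕ} {u : 𝔤.U} (hu : u ∈ 𝔤.wordFil (p + 1)) :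
    𝔤.lieProj p u ∈ LinearMap.range 𝔤.ι := by
  induction p generalizing u with
  | zero => exact convSq_sub_one_mem_range hu
  | succ p ih => exact ih (convSq_sub_mem hu)

end GrLieAlgebra

namespace DGLieAlgebra

open GrLieAlgebra FreeHomology

variable {R L : Type*} [CommRing R] [AddCommGroup L] [Module R L] (𝔏 : DGLieAlgebra R L)

/-! ### The convolution square is a chain map -/

theorem dU_mulUU (t : 𝔏.UU) : 𝔏.dU (𝔏.mulUU t) = 𝔏.mulUU (𝔏.dUU t) := by
  have : 𝔏.dU ∘ₗ 𝔏.mulUU = 𝔏.mulUU ∘ₗ 𝔏.dUU := by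
    apply 𝔏.tmulU_ext
    intro m n a b _ _
    rw [LinearMap.comp_apply, LinearMap.comp_apply, dUU_tmulU, map_add]
    exact 𝔏.dU_mul a b
  exact LinearMap.congr_fun this t

theorem dU_convSq (u : 𝔏.U) : 𝔏.dU (𝔏.convSq u) = 𝔏.convSq (𝔏.dU u) := by
  simp only [convSq, LinearMap.comp_apply, AlgHom.toLinearMap_apply, dU_mulUU, dUU_diag]

theorem dU_lieProj (p : ℕ) (u : 𝔏.U) : 𝔏.dU (𝔏.lieProj p u) = 𝔏.lieProj p (𝔏.dU u) := by
  induction p generalizing u with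
  | zero => simp [lieProj, dU_convSq]
  | succ p ih => simp [lieProj, dU_convSq, ih]

/-! ### Primitive classes -/

/-- Turns primitivity modulo torsion into an equation between chains in `UL ⊗ UL`, to which chain
maps can be applied. -/
theorem mk_mem_primitives_iff (z : LinearMap.ker 𝔏.dU) :
    FreeHomology.mk 𝔏.dU z ∈ 𝔏.primitives ↔ ∃ a ∈ nonZeroDivisors R, ∃ t,
      a • (𝔏.diag z - (𝔏.tmulU z 1 + 𝔏.tmulU 1 z)) = 𝔏.dUU t := by
  let o : LinearMap.ker 𝔏.dU := ⟨1, by simp⟩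
  let p : LinearMap.ker 𝔏.dUU := ⟨𝔏.tmulU z 1, 𝔏.tmulU_isPairing.mem_ker z o⟩
  let q : LinearMap.ker 𝔏.dUU := ⟨𝔏.tmulU 1 z, 𝔏.tmulU_isPairing.mem_ker o z⟩
  let r : LinearMap.ker 𝔏.dUU := ⟨𝔏.diag z, by
    have := z.2
    rw [LinearMap.mem_ker] at this ⊢
    rw [dUU_diag, this, map_zero]⟩
  have hk : 𝔏.kunneth (FreeHomology.mk 𝔏.dU z ⊗ₜ 𝔏.oneFHU + 𝔏.oneFHU ⊗ₜ FreeHomology.mk 𝔏.dU z) =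
      FreeHomology.mk 𝔏.dUU (p + q) := by
    rw [map_add, map_add]; rfl
  rw [mem_primitives, hk, ← sub_eq_zero]
  have hd : 𝔏.diagFH (FreeHomology.mk 𝔏.dU z) = FreeHomology.mk 𝔏.dUU r := rfl
  rw [hd, ← map_sub, mk_eq_zero_iff]
  rfl

theorem ιFH_mk (z : LinearMap.ker 𝔏.d) : 𝔏.ιFH (FreeHomology.mk 𝔏.d z) =
    FreeHomology.mk 𝔏.dU ⟨𝔏.ι z, by
      have := z.2
      rw [LinearMap.mem_ker] at this ⊢
      rw [dU_ι, this, map_zero]⟩ := rfl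

theorem ιFH_mem_primitives (x : 𝔏.FH) : 𝔏.ιFH x ∈ 𝔏.primitives := by
  obtain ⟨z, rfl⟩ := mk_surjective _ x
  rw [ιFH_mk, mk_mem_primitives_iff]
  refine ⟨1, one_mem _, 0, ?_⟩
  change (1 : R) • (𝔏.diag (𝔏.ι z) - (𝔏.tmulU (𝔏.ι z) 1 + 𝔏.tmulU 1 (𝔏.ι z))) = _
  rw [map_zero, one_smul, sub_eq_zero]
  exact 𝔏.diag_ι z

theorem ιFH_mem_grFHU {n : ℤ} {x : 𝔏.FH} (hx : x ∈ 𝔏.grFH n) : 𝔏.ιFH x ∈ 𝔏.grFHU n := by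
  obtain ⟨z, hz, rfl⟩ := hx
  exact ⟨_, ι_mem hz, rfl⟩

theorem ιFH_bracketFH {m n : ℤ} {x y : 𝔏.FH} (hx : x ∈ 𝔏.grFH m) (hy : y ∈ 𝔏.grFH n) :
    𝔏.ιFH (𝔏.bracketFH x y) = 𝔏.mulFHU (𝔏.ιFH x) (𝔏.ιFH y) -
      ksign R (m * n) • 𝔏.mulFHU (𝔏.ιFH y) (𝔏.ιFH x) := by
  obtain ⟨x, hx, rfl⟩ := hx
  obtain ⟨y, hy, rfl⟩ := hy
  simp only [bracketFH, mulFHU, map₂_mk, ιFH_mk, ← map_smul, ← map_sub]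
  congr 1
  exact Subtype.ext (𝔏.ι_bracket hx hy)

/-! ### Products of primitive classes -/

/-- The sign involution of `UL ⊗ UL`. -/
def signUU : 𝔏.UU →ₗ[R] 𝔏.UU :=
  (GradedTensorProduct.of R 𝔏.grU 𝔏.grU).toLinearMap ∘ₗ
    TensorProduct.map 𝔏.signU.toLinearMap 𝔏.signU.toLinearMap ∘ₗ
      (GradedTensorProduct.of R 𝔏.grU 𝔏.grU).symm.toLinearMap

theorem signUU_tmulU (a b : 𝔏.U) :
    𝔏.signUU (𝔏.tmulU a b) = 𝔏.tmulU (𝔏.signU a) (𝔏.signU b) := rfl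

theorem dUU_mul (s t : 𝔏.UU) : 𝔏.dUU (s * t) = 𝔏.dUU s * t + 𝔏.signUU s * 𝔏.dUU t := by
  suffices h : (LinearMap.mul R 𝔏.UU).compr₂ 𝔏.dUU =
      (LinearMap.mul R 𝔏.UU) ∘ₗ 𝔏.dUU +
        ((LinearMap.mul R 𝔏.UU).compl₂ 𝔏.dUU) ∘ₗ 𝔏.signUU from
    LinearMap.congr_fun₂ h s t
  apply 𝔏.tmulU_ext
  intro i j a b ha hb
  apply 𝔏.tmulU_ext
  intro k l a' b' ha' hb'
  replace ha := ha.mem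
  replace hb := hb.mem
  replace ha' := ha'.mem
  replace hb' := hb'.mem
  have hdb := 𝔏.dU_mem hb
  have hda' := 𝔏.dU_mem ha'
  simp only [LinearMap.compr₂_apply, LinearMap.add_apply, LinearMap.comp_apply,
    LinearMap.compl₂_apply, LinearMap.mul_apply', dUU_tmulU, signUU_tmulU, add_mul, mul_add,
    signU_apply ha, signU_apply hb, signU_apply ha', map_smul, LinearMap.smul_apply,
    smul_mul_assoc, mul_smul_comm, smul_smul]
  rw [𝔏.tmulU_mul_tmulU _ _ hb ha', 𝔏.tmulU_mul_tmulU _ _ hb ha',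
    𝔏.tmulU_mul_tmulU _ _ hdb ha', 𝔏.tmulU_mul_tmulU _ _ hb hda', 𝔏.tmulU_mul_tmulU _ _ hb ha']
  have s1 : ksign R ((j - 1) * k) = ksign R (j * k) * ksign R k := by
    rw [sub_mul, one_mul, ksign_sub]
  have s2 : ksign R (j * (k - 1)) = ksign R (j * k) * ksign R j := by
    rw [mul_sub, mul_one, ksign_sub]
  simp only [map_smul, dUU_tmulU, dU_mul, map_mul, signU_apply ha, signU_apply hb,
    signU_apply ha', map_add, LinearMap.add_apply, smul_mul_assoc, mul_smul_comm, smul_add,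
    LinearMap.smul_apply, smul_smul, s1, s2]
  -- Only the term with `d a'` needs more than linearity: there `(-1)^j` occurs twice, once from the
  -- sign involution and once from moving `b` past `d a'`.
  linear_combination (norm := module) (-(ksign R (j * k) * ksign R i)) •
    congrArg (· • 𝔏.tmulU (a * 𝔏.dU a') (b * b')) (ksign_mul_self R j)

/-- The cross terms `u ⊗ v` and `v ⊗ u` cancel by the sign rule of the graded tensor product. -/
theorem tmulU_commutator {m n : ℤ} {u v : 𝔏.U} (hu : u ∈ 𝔏.grU m) (hv : v ∈ 𝔏.grU n) :
    (𝔏.tmulU u 1 + 𝔏.tmulU 1 u) * (𝔏.tmulU v 1 + 𝔏.tmulU 1 v) -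
        ksign R (m * n) • ((𝔏.tmulU v 1 + 𝔏.tmulU 1 v) * (𝔏.tmulU u 1 + 𝔏.tmulU 1 u)) =
      𝔏.tmulU (u * v - ksign R (m * n) • (v * u)) 1 +
        𝔏.tmulU 1 (u * v - ksign R (m * n) • (v * u)) := by
  have h1 := 𝔏.one_mem_grU
  simp only [mul_add, add_mul]
  rw [𝔏.tmulU_mul_tmulU _ _ h1 hv, 𝔏.tmulU_mul_tmulU _ _ h1 h1, 𝔏.tmulU_mul_tmulU _ _ hu hv,
    𝔏.tmulU_mul_tmulU _ _ hu h1, 𝔏.tmulU_mul_tmulU _ _ h1 hu, 𝔏.tmulU_mul_tmulU _ _ h1 h1,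
    𝔏.tmulU_mul_tmulU _ _ hv hu, 𝔏.tmulU_mul_tmulU _ _ hv h1]
  have hc : ksign R (m * n) * ksign R (n * m) = 1 := by rw [mul_comm n m, ksign_mul_self]
  simp only [mul_one, one_mul, zero_mul, mul_zero, ksign_zero, one_smul, smul_add, smul_smul, hc,
    map_sub, map_smul, LinearMap.sub_apply, LinearMap.smul_apply]
  abel

/-- Up to boundaries and multiples, the diagonal of a product of two cycles with primitive
classes is the product of the corresponding primitive elements. -/
theorem exists_diag_mul_eq {m : ℤ} {a b : R} {u v : 𝔏.U} {s t : 𝔏.UU} (hu : u ∈ 𝔏.grU m)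
    (hdu : 𝔏.dU u = 0) (hdv : 𝔏.dU v = 0)
    (hs : a • (𝔏.diag u - (𝔏.tmulU u 1 + 𝔏.tmulU 1 u)) = 𝔏.dUU s)
    (ht : b • (𝔏.diag v - (𝔏.tmulU v 1 + 𝔏.tmulU 1 v)) = 𝔏.dUU t) :
    ∃ r, (a * b) • (𝔏.diag (u * v) -
      (𝔏.tmulU u 1 + 𝔏.tmulU 1 u) * (𝔏.tmulU v 1 + 𝔏.tmulU 1 v)) = 𝔏.dUU r := by
  set p := 𝔏.tmulU u 1 + 𝔏.tmulU 1 u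
  set q := 𝔏.tmulU v 1 + 𝔏.tmulU 1 v
  have hdp : 𝔏.dUU p = 0 := by simp [p, dUU_tmulU, hdu]
  have hsp : 𝔏.signUU p = ksign R m • p := by
    simp [p, signUU_tmulU, signU_apply hu]
  -- Write `Δu Δv - p q = (Δu - p) Δv + p (Δv - q)`. Since `Δv` and `p` are cycles, each summand
  -- bounds after scaling; the factor `(-1)^m` compensates the Leibniz sign.
  refine ⟨b • (s * 𝔏.diag v) + (a * ksign R m) • (p * t), ?_⟩
  rw [map_add, map_smul, map_smul, dUU_mul, dUU_mul, dUU_diag, hdv, hdp, hsp, ← hs, ← ht]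
  simp only [map_zero, mul_zero, add_zero, zero_mul, zero_add, smul_mul_assoc, mul_smul_comm,
    smul_smul, map_mul, mul_sub, sub_mul, smul_sub]
  have e : a * ksign R m * (b * ksign R m) = a * b := by
    linear_combination a * b * ksign_mul_self R m
  rw [e, mul_comm b a]
  abel

theorem commutator_mem_primitives {m n : ℤ} {x y : 𝔏.FHU} (hx : x ∈ 𝔏.primitives)
    (hxm : x ∈ 𝔏.grFHU m) (hy : y ∈ 𝔏.primitives) (hyn : y ∈ 𝔏.grFHU n) :
    𝔏.mulFHU x y - ksign R (m * n) • 𝔏.mulFHU y x ∈ 𝔏.primitives := by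
  obtain ⟨u, hu, rfl⟩ := hxm
  obtain ⟨v, hv, rfl⟩ := hyn
  replace hu : (u : 𝔏.U) ∈ 𝔏.grU m := hu
  replace hv : (v : 𝔏.U) ∈ 𝔏.grU n := hv
  obtain ⟨a, ha, s, hs⟩ := (𝔏.mk_mem_primitives_iff u).1 hx
  obtain ⟨b, hb, t, ht⟩ := (𝔏.mk_mem_primitives_iff v).1 hy
  obtain ⟨r, hr⟩ := 𝔏.exists_diag_mul_eq hu u.2 v.2 hs ht
  obtain ⟨r', hr'⟩ := 𝔏.exists_diag_mul_eq hv v.2 u.2 ht hs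
  simp only [mulFHU, map₂_mk, ← map_smul, ← map_sub]
  rw [mk_mem_primitives_iff]
  refine ⟨a * b, mul_mem ha hb, r - ksign R (m * n) • r', ?_⟩
  have hc := 𝔏.tmulU_commutator hu hv
  simp only [Submodule.coe_sub, Submodule.coe_smul, LinearMap.mul_apply']
  rw [← hc, map_sub, map_smul, map_sub 𝔏.dUU, map_smul 𝔏.dUU, ← hr, ← hr', mul_comm b a]
  simp only [smul_sub, smul_comm (ksign R (m * n))]
  abel

/-! ### Injectivity and the cokernel -/

theorem ιFH_injective [IsDomain R] [CharZero R] (hι : Function.Injective 𝔏.ι) :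
    Function.Injective 𝔏.ιFH := by
  rw [injective_iff_map_eq_zero]
  intro x hx
  obtain ⟨z, rfl⟩ := mk_surjective _ x
  rw [ιFH_mk, mk_eq_zero_iff] at hx
  obtain ⟨a, ha, w, hw⟩ := hx
  obtain ⟨p, hp⟩ := exists_mem_wordFil w
  -- `lieProj p` handles words of length up to `p + 1`; enlarging the bound by one avoids a separate
  -- case `p = 0`.
  obtain ⟨y, hy⟩ := lieProj_mem_range (wordFil_mono p.le_succ hp)
  rw [mk_eq_zero_iff]
  refine ⟨a * lieScalar R p, mul_mem ha (mem_nonZeroDivisors_of_ne_zero (lieScalar_ne_zero p)),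
    y, hι ?_⟩
  rw [← dU_ι, hy, dU_lieProj, ← hw, map_smul, map_smul, lieProj_ι, smul_smul]

/-- If the class of the cycle `u` is an eigenvector of the convolution square with eigenvalue `2`,
then `lieProj p` multiplies it by `lieScalar R p`, up to boundaries. -/
theorem exists_lieProj_sub_eq_dU {b : R} {u w : 𝔏.U} (p : ℕ)
    (h : b • (𝔏.convSq u - (2 : R) • u) = 𝔏.dU w) :
    ∃ v, b • (𝔏.lieProj p u - lieScalar R p • u) = 𝔏.dU v := by
  induction p with
  | zero =>
    refine ⟨w, ?_⟩
    rw [← h, lieProj, lieScalar, LinearMap.sub_apply, Module.End.one_apply, two_smul, one_smul]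
    congr 1
    abel
  | succ p ih =>
    obtain ⟨v, hv⟩ := ih
    -- Comes from the splitting `ψ - 2 ^ (p + 2) = (ψ - 2) + (2 - 2 ^ (p + 2))`: the first part uses
    -- `h`, the second the induction hypothesis.
    refine ⟨𝔏.lieProj p w + (2 - 2 ^ (p + 2) : R) • v, ?_⟩
    rw [map_add, map_smul, dU_lieProj, ← hv, ← h]
    simp only [lieProj, lieScalar, Module.End.mul_apply, LinearMap.sub_apply,
      LinearMap.smul_apply, Module.End.one_apply, map_sub, map_smul]
    module

theorem exists_smul_eq_ιFH [IsDomain R] [CharZero R] (hι : Function.Injective 𝔏.ι) {x : 𝔏.FHU}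
    (hx : x ∈ 𝔏.primitives) : ∃ a ∈ nonZeroDivisors R, ∃ y, a • x = 𝔏.ιFH y := by
  obtain ⟨z, rfl⟩ := mk_surjective _ x
  obtain ⟨b, hb, t, ht⟩ := (𝔏.mk_mem_primitives_iff z).1 hx
  -- Multiplying out the primitivity equation: the diagonal of `z` becomes `ψ(z)`, and `z ⊗ 1 + 1 ⊗
  -- z` becomes `2 z`.
  have h : b • (𝔏.convSq z - (2 : R) • (z : 𝔏.U)) = 𝔏.dU (𝔏.mulUU t) := by
    rw [dU_mulUU, ← ht, map_smul, map_sub, map_add, tmulU_apply, tmulU_apply, mulUU_tmul,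
      mulUU_tmul, mul_one, one_mul, two_smul]
    rfl
  obtain ⟨p, hp⟩ := exists_mem_wordFil (z : 𝔏.U)
  obtain ⟨y, hy⟩ := lieProj_mem_range (wordFil_mono p.le_succ hp)
  obtain ⟨v, hv⟩ := 𝔏.exists_lieProj_sub_eq_dU p h
  have hdy : 𝔏.d y = 0 := hι (by
    have := z.2
    rw [LinearMap.mem_ker] at this
    rw [← dU_ι, hy, dU_lieProj, this, map_zero, map_zero])
  -- The multiplier `b` is not needed here: classes are taken modulo torsion, so it is absorbed when
  -- the difference is shown to vanish.
  refine ⟨lieScalar R p, mem_nonZeroDivisors_of_ne_zero (lieScalar_ne_zero p),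
    FreeHomology.mk 𝔏.d ⟨y, hdy⟩, ?_⟩
  rw [ιFH_mk, ← map_smul, ← sub_eq_zero, ← map_sub, mk_eq_zero_iff]
  refine ⟨b, hb, -v, ?_⟩
  rw [map_neg, ← hv, ← hy, ← smul_neg, neg_sub]
  rfl

/-- A linear map has torsion cokernel if every element of its target has a multiple, by a
non-zero-divisor, in its range. -/
theorem isTorsion_quotient_range {A M N : Type*} [CommRing A] [AddCommGroup M] [Module A M]
    [AddCommGroup N] [Module A N] (f : M →ₗ[A] N)
    (h : ∀ x, ∃ a ∈ nonZeroDivisors A, ∃ y, a • x = f y) :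
    Module.IsTorsion A (N ⧸ LinearMap.range f) := by
  intro x
  obtain ⟨x, rfl⟩ := (LinearMap.range f).mkQ_surjective x
  obtain ⟨a, ha, y, hy⟩ := h x
  refine ⟨⟨a, ha⟩, ?_⟩
  change a • (LinearMap.range f).mkQ x = 0
  rw [← map_smul, Submodule.mkQ_apply, Submodule.Quotient.mk_eq_zero]
  exact ⟨y, hy.symm⟩

end DGLieAlgebra

end

theorem mainTheorem7 {R : Type*} [CommRing R] [IsDomain R] [IsPrincipalIdealRing R] [CharZero R]
    (h2 : IsUnit (2 : R))
    {L : Type*} [AddCommGroup L] [Module R L] (𝔏 : DGLieAlgebra R L)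
    (hconn : 𝔏.Connected)
    (hfree : ∀ n, Module.Free R (𝔏.gr n))
    (hfin : ∀ n, Module.Finite R (𝔏.gr n)) :
    -- `P` is closed under the graded commutator of `F H(UL)`
    (∀ (m n : ℤ) (x y : 𝔏.FHU), x ∈ 𝔏.primitives → x ∈ 𝔏.grFHU m →
      y ∈ 𝔏.primitives → y ∈ 𝔏.grFHU n →
        𝔏.mulFHU x y - ksign R (m * n) • 𝔏.mulFHU y x ∈ 𝔏.primitives) ∧
    -- the induced map has values in `P`, ...
    ∃ φ : 𝔏.FH →ₗ[R] 𝔏.primitives,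
      (∀ x, (φ x : 𝔏.FHU) = 𝔏.ιFH x) ∧
      -- ... is a morphism of graded Lie algebras, ...
      (∀ (n : ℤ) (x : 𝔏.FH), x ∈ 𝔏.grFH n → (φ x : 𝔏.FHU) ∈ 𝔏.grFHU n) ∧
      (∀ (m n : ℤ) (x y : 𝔏.FH), x ∈ 𝔏.grFH m → y ∈ 𝔏.grFH n →
        (φ (𝔏.bracketFH x y) : 𝔏.FHU) =
          𝔏.mulFHU (φ x) (φ y) - ksign R (m * n) • 𝔏.mulFHU (φ y) (φ x)) ∧
      -- ... is injective, and has torsion cokernel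
      Function.Injective φ ∧
      Module.IsTorsion R (𝔏.primitives ⧸ LinearMap.range φ) := by
  have htf : ∀ n, Module.IsTorsionFree R (𝔏.gr n) := fun n => have := hfree n; inferInstance
  have hι := 𝔏.ι_injective hconn htf
  refine ⟨fun m n x y hx hxm hy hyn => 𝔏.commutator_mem_primitives hx hxm hy hyn,
    𝔏.ιFH.codRestrict 𝔏.primitives 𝔏.ιFH_mem_primitives, fun _ => rfl,
    fun n x hx => 𝔏.ιFH_mem_grFHU hx, fun m n x y hx hy => 𝔏.ιFH_bracketFH hx hy,
    fun x y h => 𝔏.ιFH_injective hι (congrArg Subtype.val h),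
    DGLieAlgebra.isTorsion_quotient_range _ fun x => ?_⟩
  obtain ⟨a, ha, y, hy⟩ := 𝔏.exists_smul_eq_ιFH hι x.2
  exact ⟨a, ha, y, Subtype.ext hy⟩
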